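/- Let $(R,\mathfrak m)$ be a Noetherian local ring with infinite residue field $k$ and let $I$ be an $R$-ideal. Write $\mathcal R=\bigoplus_{j\ge 0} I^j$ for the Rees algebra of $I$, let $\ell=\dim \mathcal R/\mathfrak m\mathcal R$ be the analytic spread of $I$, and let $r$ be the reduction number of $I$, that is, the least integer $n\ge 0$ such that $I^{n+1}=JI^n$ for some minimal reduction $J$ of $I$ (a reduction of $I$ is an ideal $J\subseteq I$ with $I^{n+1}=JI^n$ for some $n\geq 0$; minimal means minimal with respect to containment). Then the following holds for general elements $a_1,\dots,a_\ell$ of $I$; this means: for every finite generating family $f_1,\dots,f_n$ of $I$ there is a dense Zariski open subset $U$ of the affine space $k^{\ell n}$ such that the following holds for all $a_i=\sum_{s=1}^n x_{is}f_s$ $(1\le i\le \ell)$ whose coefficients $x_{is}\in R$ have residue classes $(\bar x_{is})\in U$. Set $\mathfrak a_i=(a_1,\dots,a_i)$ for $0\le i\le \ell$ and $J=\mathfrak a_\ell=(a_1,\dots,a_\ell)$, and assume that $$(\mathfrak a_i I^{j-1}:a_{i+1})\cap I^j=\mathfrak a_i I^{j-1}\qquad\text{whenever } 0\le i\le \ell-1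 \text{ and } 1\le j\le \max\{1,r\}.$$ Then for every $\mathfrak m$-primary ideal $K$ of $R$ the following are equivalent: (i) $\mathcal R/K\mathcal R$ is Cohen–Macaulay; (ii) $J/KJ$ is a free $R/K$-module, and $JI^{j-1}\cap KI^j=JKI^{j-1}$ whenever $1\le j\le r$. -/

import Mathlib

/-- `𝓡 / K𝓡`, where `𝓡 = ⨁ Iʲ` is the Rees algebra of `I` and `K` is an ideal of `R`. -/
abbrev ReesQuotient {R : Type*} [CommRing R] (I K : Ideal R) : Type _ :=
  reesAlgebra I ⧸ K.map (algebraMap R (reesAlgebra I))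

/-- The analytic spread of `I`: the Krull dimension of the special fiber ring `𝓡 / 𝔪𝓡`. -/
noncomputable def analyticSpread {R : Type*} [CommRing R] [IsLocalRing R] (I : Ideal R) :
    WithBot ℕ∞ :=
  ringKrullDim (ReesQuotient I (IsLocalRing.maximalIdeal R))

/-- `J` is a reduction of `I`. -/
def IsReduction {R : Type*} [CommRing R] (J I : Ideal R) : Prop :=
  J ≤ I ∧ ∃ n : ℕ, I ^ (n + 1) = J * I ^ n

/-- `J` is a reduction of `I`, minimal with respect to containment. -/
def IsMinimalReduction {R : Type*} [CommRing R] (J I : Ideal R) : Prop :=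
  Minimal (fun J' : Ideal R => IsReduction J' I) J

/-- The reduction number `r_J(I)` of `I` with respect to a reduction `J` of `I`. -/
noncomputable def reductionNumberWrt {R : Type*} [CommRing R] (J I : Ideal R) : ℕ :=
  sInf {n : ℕ | I ^ (n + 1) = J * I ^ n}

/-- The reduction number of `I`: the least `r_J(I)`, where `J` varies over all minimal reductions
of `I` (in a Noetherian local ring minimal reductions exist). -/
noncomputable def reductionNumber {R : Type*} [CommRing R] (I : Ideal R) : ℕ :=
  sInf {n : ℕ | ∃ J : Ideal R, IsMinimalReduction J I ∧ reductionNumberWrt J I = n}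

/-- A Noetherian local ring is Cohen–Macaulay if its maximal ideal contains a regular sequence
whose length is the Krull dimension, i.e. if its depth equals its dimension. -/
def IsCohenMacaulayLocal (A : Type*) [CommRing A] [IsLocalRing A] : Prop :=
  IsNoetherianRing A ∧ ∃ xs : List A, (∀ x ∈ xs, x ∈ IsLocalRing.maximalIdeal A) ∧
    RingTheory.Sequence.IsRegular A xs ∧ (xs.length : WithBot ℕ∞) = ringKrullDim A

/-- A Noetherian ring is Cohen–Macaulay if its localization at every maximal ideal is. -/
def IsCohenMacaulay (A : Type*) [CommRing A] : Prop :=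
  IsNoetherianRing A ∧ ∀ (n : Ideal A) [n.IsMaximal],
    IsCohenMacaulayLocal (Localization.AtPrime n)

/-- The property `P` holds for `ℓ` general elements `a₁, …, a_ℓ` of the ideal `I` of the local
ring `R` with (infinite) residue field `k`: for every finite generating family `f₁, …, f_n` of `I`
there is a nonempty (basic) Zariski open subset `{g ≠ 0}` of the affine space `k ^ (ℓ × n)`
such that `P` holds for all `aᵢ = ∑ₛ xᵢₛ fₛ` for which the image of the coefficient
matrix `x` over `k` lies in that open set. -/
def HoldsForGeneral {R : Type*} [CommRing R] [IsLocalRing R] (I : Ideal R) (ℓ : ℕ)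
    (P : (Fin ℓ → R) → Prop) : Prop :=
  ∀ (n : ℕ) (f : Fin n → R), Ideal.span (Set.range f) = I →
    ∃ g : MvPolynomial (Fin ℓ × Fin n) (IsLocalRing.ResidueField R), g ≠ 0 ∧
      ∀ x : Fin ℓ × Fin n → R,
        MvPolynomial.eval (fun p => IsLocalRing.residue R (x p)) g ≠ 0 →
          P (fun i => ∑ s, x (i, s) * f s)

/-- The ideal `𝔞ᵢ = (a₁, …, aᵢ)` generated by the first `i` members of `a`. -/
def initialIdeal {R : Type*} [CommRing R] {ℓ : ℕ} (a : Fin ℓ → R) (i : ℕ) : Ideal R :=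
  Ideal.span (a '' {s | (s : ℕ) < i})

/-! Write `G = 𝓡 / K𝓡` and let `M` be its homogeneous maximal ideal. Everything passes through one
condition: the classes `a₁t, …, a_ℓt` form a regular sequence on `G`. As these elements are
homogeneous, the condition can be read off degree by degree as a statement about ideals of `R`,
through `coeffIdeal`.

The open set. Some minimal reduction generated by `ℓ` elements attains the reduction number `r`. The
equation `I^(r+1) = J I^r` holds wherever a certain determinant is nonzero modulo `𝔪`, and that
determinant does not vanish at this minimal reduction (`exists_mvPolynomial_pow_succ_eq`). So the
open set depends on neither `K` nor the colon conditions.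

Cohen–Macaulay versus regular. Both `dim G` and the height of `M` equal `ℓ`, and `M` is the radical
of `(a₁t, …, a_ℓt)`. If `G` is Cohen–Macaulay, this system of parameters is regular in `G_M`, and
the relations descend to `G` because an element outside `M` has a unit in degree 0
(`regular_of_isCohenMacaulay_reesFiber`). For the converse every maximal ideal `n` counts,
homogeneous or not: monic polynomials in the `aᵢt` that lie in `n` have the powers of `aᵢt` as
leading forms, hence again form a regular sequence of length `ℓ = dim G`
(`isCohenMacaulay_reesFiber_of_regular`).

Regular versus (ii). The colon conditions give `𝔞ᵢ ∩ I^(j+1) = 𝔞ᵢ I^j` for all `j` and all `i < ℓ`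
(`initialIdeal_inf_pow_le`). Freeness of `J/KJ` governs degree 0, and the intersections `J I^(j-1) ∩
K I^j` govern the higher degrees (`regular_of_basis`, `coeff_mem_of_regular`,
`initialIdeal_mul_inf_le_of_regular`). -/

/-! ### Depth over local rings: systems of parameters are regular sequences. -/

section LocalDepth

open IsLocalRing RingTheory.Sequence CategoryTheory Abelian
open scoped Pointwise

universe u

variable {A : Type u} [CommRing A] [IsLocalRing A] [IsNoetherianRing A]

/-- Let `N` be the submodule killed by `P`. If `N ⊆ xM`, then `N = xN` by regularity of `x`, and
Nakayama gives `N = 0`. So some element of `N` survives in `M/xM`, and an associated prime above its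
annihilator contains both `P` and `x`. -/
theorem exists_lt_mem_associatedPrimes_quotSMulTop {M : Type u} [AddCommGroup M] [Module A M]
    [Module.Finite A M] {P : Ideal A} (hP : P ∈ associatedPrimes A M) {x : A}
    (hx : x ∈ maximalIdeal A) (hreg : IsSMulRegular M x) :
    ∃ Q ∈ associatedPrimes A (QuotSMulTop x M), P < Q := by
  have hPp : P.IsPrime := hP.isPrime
  obtain ⟨-, u, hu⟩ := (isAssociatedPrime_iff).1 hP
  let N : Submodule A M :=
    { carrier := {m | ∀ p ∈ P, p • m = 0}
      add_mem' := fun {a b} ha hb p hp => by rw [smul_add, ha p hp, hb p hp, add_zero]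
      zero_mem' := fun p _ => smul_zero p
      smul_mem' := fun c m hm p hp => by rw [smul_comm, hm p hp, smul_zero] }
  have hmemN : ∀ m, m ∈ N ↔ ∀ p ∈ P, p • m = 0 := fun m => Iff.rfl
  have huP : ∀ p, p ∈ P ↔ p • u = 0 := fun p => by
    rw [hu, Submodule.mem_colon_singleton]; simp
  have huN : u ∈ N := fun p hp => (huP p).1 hp
  have hu0 : u ≠ 0 := fun h => hPp.ne_top <| (Ideal.eq_top_iff_one _).2 <| by
    rw [huP, h, smul_zero]
  have hex : ∃ m ∈ N, m ∉ x • (⊤ : Submodule A M) := by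
    by_contra! hcon
    have hle : N ≤ Ideal.span {x} • N := by
      intro n hn
      obtain ⟨m', -, rfl⟩ := hcon n hn
      have hm' : m' ∈ N := fun p hp => hreg <| by
        have := (hmemN _).1 hn p hp
        simp only [DistribSMul.toLinearMap_apply, smul_zero] at this ⊢
        rw [smul_comm, this]
      exact Submodule.smul_mem_smul (Ideal.mem_span_singleton_self x) hm'
    have hbot : N = ⊥ := Submodule.eq_bot_of_le_smul_of_le_jacobson_bot _ N
      (IsNoetherian.noetherian N) hle <| by
        rw [IsLocalRing.jacobson_eq_maximalIdeal _ bot_ne_top, Ideal.span_singleton_le_iff_mem]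
        exact hx
    rw [hbot, Submodule.mem_bot] at huN
    exact hu0 huN
  obtain ⟨m, hmN, hmx⟩ := hex
  have hm0 : (Submodule.mkQ (x • (⊤ : Submodule A M)) m : QuotSMulTop x M) ≠ 0 := by
    rwa [Submodule.mkQ_apply, Ne, Submodule.Quotient.mk_eq_zero]
  obtain ⟨Q, hQ, hle⟩ := exists_le_isAssociatedPrime_of_isNoetherianRing A _ hm0
  refine ⟨Q, hQ, lt_of_le_of_ne ?_ ?_⟩
  · intro p hp
    apply hle
    rw [Submodule.mem_colon_singleton, ← map_smul, hmN p hp, map_zero]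
    exact Submodule.zero_mem _
  · rintro rfl
    have hxP : x ∈ P := by
      apply hle
      rw [Submodule.mem_colon_singleton, ← map_smul, Submodule.mem_bot, Submodule.mkQ_apply,
        Submodule.Quotient.mk_eq_zero]
      exact Submodule.smul_mem_pointwise_smul _ _ _ trivial
    exact hu0 (hreg (by simpa using (huP x).1 hxP))

/-- Each regular element moves an associated prime strictly up, so the dimension of the quotient
drops by at least one each time. -/
theorem length_le_ringKrullDim_of_mem_associatedPrimes (rs : List A)
    (hrs : ∀ r ∈ rs, r ∈ maximalIdeal A) {M : Type u} [AddCommGroup M] [Module A M]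
    [Module.Finite A M] (hreg : IsRegular M rs) {P : Ideal A} (hP : P ∈ associatedPrimes A M) :
    (rs.length : WithBot ℕ∞) ≤ ringKrullDim (A ⧸ P) := by
  induction rs generalizing M P with
  | nil =>
    have hPp : P.IsPrime := hP.isPrime
    simpa using ringKrullDim_nonneg_of_nontrivial
  | cons x rs ih =>
    have hPp : P.IsPrime := hP.isPrime
    obtain ⟨h1, h2⟩ := (isRegular_cons_iff M x rs).1 hreg
    obtain ⟨Q, hQ, hlt⟩ := exists_lt_mem_associatedPrimes_quotSMulTop hP
      (hrs x (by simp)) h1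
    have := ih (fun r hr => hrs r (by simp [hr])) h2 hQ
    obtain ⟨y, hyQ, hyP⟩ := SetLike.exists_of_lt hlt
    have hsucc := ringKrullDim_succ_le_of_surjective (Ideal.Quotient.factor hlt.le)
      (Ideal.Quotient.factor_surjective hlt.le) (r := Ideal.Quotient.mk P y)
      (mem_nonZeroDivisors_of_ne_zero (by rwa [Ne, Ideal.Quotient.eq_zero_iff_mem]))
      (by simpa [Ideal.Quotient.eq_zero_iff_mem] using hyQ)
    push_cast [List.length_cons]
    exact (add_le_add_left this 1).trans hsucc

theorem ringKrullDim_quotient_le_length_of_le_radical (P : Ideal A) [P.IsPrime] (xs : List A)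
    (hxs : ∀ r ∈ xs, r ∈ maximalIdeal A)
    (h : maximalIdeal A ≤ (P ⊔ Ideal.ofList xs).radical) :
    ringKrullDim (A ⧸ P) ≤ xs.length := by
  classical
  have : IsLocalRing (A ⧸ P) :=
    IsLocalRing.of_surjective' (Ideal.Quotient.mk P) Ideal.Quotient.mk_surjective
  let f := Ideal.Quotient.mk P
  let s : Finset (A ⧸ P) := (xs.map f).toFinset
  have hs : (s : Set (A ⧸ P)) ⊆ maximalIdeal (A ⧸ P) := by
    intro y hy
    simp only [s, List.coe_toFinset, List.mem_map, Set.mem_ofPred_eq] at hy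
    obtain ⟨a, ha, rfl⟩ := hy
    rw [SetLike.mem_coe, IsLocalRing.mem_maximalIdeal]
    have := Function.Surjective.isLocalHom f Ideal.Quotient.mk_surjective
    exact fun hu => (IsLocalRing.mem_maximalIdeal a).1 (hxs a ha) (isUnit_of_map_unit f a hu)
  refine (ringKrullDim_le_ringKrullDim_quotient_add_card s (hs.trans ?_)).trans ?_
  · rw [IsLocalRing.ringJacobson_eq_maximalIdeal]
  have hspan : Ideal.span (s : Set (A ⧸ P)) = (Ideal.ofList xs).map f := by
    rw [Ideal.map_ofList, Ideal.ofList]; simp [s]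
  have hmax : maximalIdeal (A ⧸ P) ≤ (Ideal.span (s : Set (A ⧸ P))).radical := by
    intro y hy
    obtain ⟨a, rfl⟩ := Ideal.Quotient.mk_surjective y
    have ha : a ∈ maximalIdeal A := by
      rw [IsLocalRing.mem_maximalIdeal, mem_nonunits_iff] at hy ⊢
      exact fun hu => hy (hu.map f)
    obtain ⟨n, hn⟩ := h ha
    refine ⟨n, ?_⟩
    rw [hspan, ← map_pow]
    have := Ideal.mem_map_of_mem f hn
    rwa [Ideal.map_sup, Ideal.map_quotient_self, bot_sup_eq] at this
  have hle : ringKrullDim ((A ⧸ P) ⧸ Ideal.span (s : Set (A ⧸ P))) ≤ 0 := by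
    have : Ring.KrullDimLE 0 ((A ⧸ P) ⧸ Ideal.span (s : Set (A ⧸ P))) := by
      refine Ring.KrullDimLE.mk₀ fun q hq => ?_
      have hcm : maximalIdeal (A ⧸ P) ≤ q.comap (Ideal.Quotient.mk _) := by
        refine hmax.trans ((Ideal.IsPrime.radical_le_iff inferInstance).2 ?_)
        intro z hz
        rw [Ideal.mem_comap, Ideal.Quotient.eq_zero_iff_mem.2 hz]
        exact q.zero_mem
      have hmx : (q.comap (Ideal.Quotient.mk (Ideal.span (s : Set (A ⧸ P))))).IsMaximal := by
        have := (IsLocalRing.maximalIdeal.isMaximal (A ⧸ P)).eq_of_le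
          (Ideal.IsPrime.ne_top inferInstance) hcm
        rw [← this]; infer_instance
      exact Ideal.map_comap_of_surjective _ Ideal.Quotient.mk_surjective q ▸
        (Ideal.map_eq_top_or_isMaximal_of_surjective _ Ideal.Quotient.mk_surjective
          hmx).resolve_left
          (by rw [Ideal.map_comap_of_surjective _ Ideal.Quotient.mk_surjective]; exact hq.ne_top)
    simpa [Ring.KrullDimLE, Order.krullDimLE_iff, ringKrullDim] using this
  calc _ ≤ (0 : WithBot ℕ∞) + s.card := add_le_add_left hle _
    _ ≤ _ := by
      rw [zero_add]
      have : s.card ≤ xs.length := (List.toFinset_card_le _).trans (by simp)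
      exact_mod_cast this

/-- Depth drops by only one for any choice of regular `x`: it is detected by vanishing of Ext, and
the long exact sequence of multiplication by `x` shifts degrees by one. -/
theorem exists_isRegular_quotSMulTop {M : Type u} [AddCommGroup M] [Module A M]
    [Module.Finite A M] {n : ℕ} (h : ∃ rs : List A, rs.length = n + 1 ∧
      (∀ r ∈ rs, r ∈ maximalIdeal A) ∧ IsRegular M rs) {x : A} (hx : x ∈ maximalIdeal A)
    (hreg : IsSMulRegular M x) :
    ∃ rs : List A, rs.length = n ∧ (∀ r ∈ rs, r ∈ maximalIdeal A) ∧
      IsRegular (QuotSMulTop x M) rs := by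
  have hM : Nontrivial M := by obtain ⟨rs, -, -, h⟩ := h; exact h.nontrivial
  have hlt : ∀ (N : Type u) [AddCommGroup N] [Module A N] [Module.Finite A N] [Nontrivial N],
      maximalIdeal A • (⊤ : Submodule A N) < ⊤ := fun N => by
    intros
    exact lt_top_iff_ne_top.2 (Submodule.top_ne_ideal_smul_of_le_jacobson_annihilator
      (IsLocalRing.maximalIdeal_le_jacobson _)).symm
  have h2 := ((ModuleCat.exists_isRegular_tfae (maximalIdeal A) (n + 1) (ModuleCat.of A M)
    (hlt M)).out 1 3).2 h
  have hQ : Nontrivial (QuotSMulTop x M) :=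
    nontrivial_quotSMulTop_of_mem_maximalIdeal _ hx
  refine ((ModuleCat.exists_isRegular_tfae (maximalIdeal A) n
    (ModuleCat.of A (QuotSMulTop x M)) (hlt _)).out 1 3).1 fun i hi => ?_
  have zero1 := AddCommGrpCat.isZero_of_iff_subsingleton.mpr (h2 i (by omega))
  have zero2 := AddCommGrpCat.isZero_of_iff_subsingleton.mpr (h2 (i + 1) (by omega))
  exact AddCommGrpCat.subsingleton_of_isZero <| ShortComplex.Exact.isZero_of_both_zeros
    ((Ext.covariant_sequence_exact₃' _
      (IsSMulRegular.smulShortComplex_shortExact (M := ModuleCat.of A M) hreg)) i (i + 1) rfl)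
    (zero1.eq_zero_of_src _) (zero2.eq_zero_of_tgt _)

theorem isRegular_of_maximalIdeal_le_radical (xs : List A) (hxs : ∀ r ∈ xs, r ∈ maximalIdeal A)
    {M : Type u} [AddCommGroup M] [Module A M] [Module.Finite A M]
    (h : ∃ rs : List A, rs.length = xs.length ∧ (∀ r ∈ rs, r ∈ maximalIdeal A) ∧ IsRegular M rs)
    (hrad : maximalIdeal A ≤ (Module.annihilator A M ⊔ Ideal.ofList xs).radical) :
    IsRegular M xs := by
  induction xs generalizing M with
  | nil =>
    obtain ⟨rs, -, -, h⟩ := h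
    have := h.nontrivial
    exact IsRegular.nil A M
  | cons x xs ih =>
    have hx := hxs x (by simp)
    -- A zero divisor `x` lies in an associated prime `P`. Then `A/P` has dimension at least the
    -- depth, yet the remaining `xs`, one element fewer, already cut it down to dimension 0.
    have hreg : IsSMulRegular M x := by
      by_contra hcon
      have hmem : x ∈ ⋃ p ∈ associatedPrimes A M, (p : Set A) := by
        rw [biUnion_associatedPrimes_eq_compl_regular]; exact hcon
      simp only [Set.mem_iUnion, SetLike.mem_coe] at hmem
      obtain ⟨P, hP, hxP⟩ := hmem
      have hPp : P.IsPrime := hP.isPrime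
      obtain ⟨rs, hlen, hrs, hr⟩ := h
      have h1 := length_le_ringKrullDim_of_mem_associatedPrimes rs hrs hr hP
      have h2 := ringKrullDim_quotient_le_length_of_le_radical P xs
        (fun r hr => hxs r (by simp [hr])) <| hrad.trans <| Ideal.radical_mono <| by
          rw [Ideal.ofList_cons, ← sup_assoc]
          refine sup_le_sup
            (sup_le (Submodule.annihilator_top (R := A) (M := M) ▸ hP.annihilator_le) ?_) le_rfl
          rwa [Ideal.span_singleton_le_iff_mem]
      have := h1.trans h2
      rw [hlen, List.length_cons] at this
      norm_cast at this
      omega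
    refine (isRegular_cons_iff M x xs).2 ⟨hreg, ih (fun r hr => hxs r (by simp [hr]))
      (exists_isRegular_quotSMulTop h hx hreg) (hrad.trans (Ideal.radical_mono ?_))⟩
    rw [Ideal.ofList_cons, ← sup_assoc]
    refine sup_le_sup (sup_le ?_ ?_) le_rfl
    · exact LinearMap.annihilator_le_of_surjective (Submodule.mkQ _) (Submodule.mkQ_surjective _)
    · rw [Ideal.span_singleton_le_iff_mem, Module.mem_annihilator]
      intro m
      obtain ⟨m, rfl⟩ := Submodule.mkQ_surjective _ m
      rw [← map_smul, Submodule.mkQ_apply, Submodule.Quotient.mk_eq_zero]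
      exact Submodule.smul_mem_pointwise_smul _ _ _ trivial

end LocalDepth

/-! ### Regular sequences and leading forms in a filtered ring. -/

section StrictFiltration

variable {R C : Type*} [CommRing R] [CommRing C] [Algebra R C]

theorem Ideal.mem_sup_span_singleton_iff {N : Ideal C} {x a : C} :
    a ∈ N ⊔ Ideal.span {x} ↔ ∃ w, a - x * w ∈ N := by
  rw [Submodule.mem_sup]
  constructor
  · rintro ⟨n, hn, y, hy, rfl⟩
    obtain ⟨w, rfl⟩ := Ideal.mem_span_singleton.1 hy
    exact ⟨w, by simpa using hn⟩
  · rintro ⟨w, hw⟩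
    exact ⟨_, hw, _, Ideal.mem_span_singleton.2 ⟨w, rfl⟩, by ring⟩

/-- A predicate `P N x` on an ideal and an element holds along the sequence `xs`, the ideal being
enlarged by the elements that have already been treated. -/
def HoldsAlong (P : Ideal C → C → Prop) : Ideal C → List C → Prop
  | _, [] => True
  | N, x :: xs => P N x ∧ HoldsAlong P (N ⊔ Ideal.span {x}) xs

theorem holdsAlong_iff (P : Ideal C → C → Prop) (N : Ideal C) (xs : List C) :
    HoldsAlong P N xs ↔
      ∀ (i : ℕ) (h : i < xs.length), P (N ⊔ Ideal.ofList (xs.take i)) xs[i] := by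
  induction xs generalizing N with
  | nil => simp [HoldsAlong]
  | cons x xs ih =>
    rw [HoldsAlong, ih]
    constructor
    · rintro ⟨h0, h⟩ (_ | i) hi
      · simpa using h0
      · simpa [sup_assoc] using h i (by simpa using hi)
    · intro h
      refine ⟨?_, fun i hi => ?_⟩
      · have := h 0 (by simp)
        rw [List.getElem_cons_zero] at this
        simpa using this
      · have := h (i + 1) (by simpa using hi)
        rw [List.getElem_cons_succ] at this
        simpa [sup_assoc] using this

theorem isWeaklyRegular_iff_holdsAlong (xs : List C) :
    RingTheory.Sequence.IsWeaklyRegular C xs ↔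
      HoldsAlong (fun N x => ∀ u, x * u ∈ N → u ∈ N) ⊥ xs := by
  rw [holdsAlong_iff, RingTheory.Sequence.isWeaklyRegular_iff]
  refine forall₂_congr fun i hi => ?_
  rw [isSMulRegular_quotient_iff_mem_of_smul_mem]
  simp

variable (Fil : ℤ → Submodule R C)

/-- Multiplication by `x` modulo `N` is injective on the graded pieces of the filtration. -/
def StrictMod (N : Ideal C) (d : ℤ) (x : C) : Prop :=
  ∀ (e : ℤ) (u f : C), f ∈ Fil (e + d) → x * u - f ∈ N → ∃ v ∈ Fil e, u - v ∈ N

/-- `z` has the leading form `h` of degree `d`. -/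
def HasLeadingForm (d : ℤ) (h z : C) : Prop :=
  ∀ (e : ℤ), ∀ u ∈ Fil e, z * u - h * u ∈ Fil (e + d - 1)

variable {Fil} {N : Ideal C}

theorem StrictMod.pow {x : C} (h : StrictMod Fil N 1 x) (d : ℕ) :
    StrictMod Fil N d (x ^ d) := by
  induction d with
  | zero => exact fun e u f hf hu => ⟨f, by simpa using hf, by simpa using hu⟩
  | succ d ih =>
    intro e u f hf hu
    obtain ⟨v, hv, hv'⟩ := ih (e + 1) (x * u) f (by convert hf using 2; push_cast; ring)
      (by convert hu using 1; ring)
    exact h e u v hv hv'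

variable (hmono : Monotone Fil) (hexh : ∀ u, ∃ e, u ∈ Fil e) 

include hmono hexh in
theorem exists_nat_add_mem (e : ℤ) (u : C) : ∃ m : ℕ, u ∈ Fil (e + m) := by
  obtain ⟨E, hE⟩ := hexh u
  exact ⟨(E - e).toNat, hmono (by have := Int.self_le_toNat (E - e); omega) hE⟩

include hmono hexh in
-- Replacing `z` by its leading form changes the product only in lower degree, so the excess degree
-- `m` of `u` can be lowered one unit at a time.
theorem StrictMod.of_hasLeadingForm {d : ℤ} {h z : C} (hh : StrictMod Fil N d h)
    (hz : HasLeadingForm Fil d h z) : StrictMod Fil N d z := by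
  intro e u f hf hu
  obtain ⟨m, hm⟩ := exists_nat_add_mem hmono hexh e u
  induction m generalizing u with
  | zero => exact ⟨u, by simpa using hm, by simp⟩
  | succ m ih =>
    have h1 := hz _ u hm
    obtain ⟨v, hv, hv'⟩ := hh (e + m) u (f - (z * u - h * u))
      (Submodule.sub_mem _ (hmono (by omega) hf) (hmono (by push_cast; omega) h1))
      (by convert hu using 1; ring)
    obtain ⟨w, hw, hw'⟩ := ih v (by
      convert N.sub_mem hu (N.mul_mem_left z hv') using 1; ring) hv
    exact ⟨w, hw, by convert N.add_mem hv' hw' using 1; ring⟩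

theorem StrictMod.sup_pow {x y : C} (hx1 : ∀ e, ∀ u ∈ Fil e, x * u ∈ Fil (e + 1))
    (hy1 : ∀ e, ∀ u ∈ Fil e, y * u ∈ Fil (e + 1)) (hx : StrictMod Fil N 1 x)
    (hy : StrictMod Fil (N ⊔ Ideal.span {x}) 1 y) (d : ℕ) :
    StrictMod Fil (N ⊔ Ideal.span {x ^ d}) 1 y := by
  induction d with
  | zero =>
    intro e u f _ _
    exact ⟨0, Submodule.zero_mem _, by simp⟩
  | succ d ih =>
    intro e u f hf hu
    obtain ⟨w, hw⟩ := Ideal.mem_sup_span_singleton_iff.1 hu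
    obtain ⟨f1, hf1, h1⟩ := hy e u f hf (Ideal.mem_sup_span_singleton_iff.2
      ⟨x ^ d * w, by convert hw using 1; ring⟩)
    obtain ⟨u', hu'⟩ := Ideal.mem_sup_span_singleton_iff.1 h1
    obtain ⟨f2, hf2, h2⟩ := hx e (y * u' - x ^ d * w) (f - y * f1)
      (Submodule.sub_mem _ hf (hy1 e f1 hf1))
      (by convert N.sub_mem hw (N.mul_mem_left y hu') using 1; ring)
    obtain ⟨f3, hf3, h3⟩ := ih (e - 1) u' f2 (by simpa using hf2)
      (Ideal.mem_sup_span_singleton_iff.2 ⟨w, by convert h2 using 1; ring⟩)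
    obtain ⟨w', hw'⟩ := Ideal.mem_sup_span_singleton_iff.1 h3
    refine ⟨f1 + x * f3, Submodule.add_mem _ hf1 (by simpa using hx1 _ _ hf3),
      Ideal.mem_sup_span_singleton_iff.2 ⟨w', ?_⟩⟩
    convert N.add_mem hu' (N.mul_mem_left x hw') using 1; ring

include hmono hexh in
-- Modulo `N + (x^d)` the result is `StrictMod.sup_pow`; it is carried over to `N + (z)` by
-- induction on the excess degree of `u`.
theorem StrictMod.sup_of_hasLeadingForm {x y z : C} {d : ℕ}
    (hx1 : ∀ e, ∀ u ∈ Fil e, x * u ∈ Fil (e + 1))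
    (hy1 : ∀ e, ∀ u ∈ Fil e, y * u ∈ Fil (e + 1)) (hx : StrictMod Fil N 1 x)
    (hy : StrictMod Fil (N ⊔ Ideal.span {x}) 1 y) (hz : HasLeadingForm Fil d (x ^ d) z) :
    StrictMod Fil (N ⊔ Ideal.span {z}) 1 y := by
  have hzs : StrictMod Fil N d z := (hx.pow d).of_hasLeadingForm hmono hexh hz
  intro e u f hf hu
  obtain ⟨m, hm⟩ := exists_nat_add_mem hmono hexh e u
  induction m generalizing u with
  | zero => exact ⟨u, by simpa using hm, by simp⟩
  | succ m ih =>
    obtain ⟨v, hv⟩ := Ideal.mem_sup_span_singleton_iff.1 hu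
    -- The cofactor `v` has no degree bound. Strictness of `z` supplies a bounded representative
    -- modulo `N`, after which `z * v1` can be traded for `x ^ d * v1` at the cost of a term in `Fil
    -- (e + m + 1)`. The same is done with `w` below, using `x ^ d`.
    obtain ⟨v1, hv1, hv1'⟩ := hzs (e + m + 2 - d) v (y * u - f)
      (Submodule.sub_mem _ (hmono (by push_cast; omega) (hy1 _ u hm)) (hmono (by omega) hf))
      (by convert N.neg_mem hv using 1; ring)
    obtain ⟨f', hf', h'⟩ := StrictMod.sup_pow hx1 hy1 hx hy d (e + m) u
      (f + (z * v1 - x ^ d * v1))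
      (Submodule.add_mem _ (hmono (by omega) hf) (hmono (by omega) (hz _ v1 hv1)))
      (Ideal.mem_sup_span_singleton_iff.2 ⟨v1, by
        convert N.add_mem hv (N.mul_mem_left z hv1') using 1; ring⟩)
    obtain ⟨w, hw⟩ := Ideal.mem_sup_span_singleton_iff.1 h'
    obtain ⟨w1, hw1, hw1'⟩ := hx.pow d (e + m + 1 - d) w (u - f')
      (Submodule.sub_mem _ (hmono (by push_cast; omega) hm) (hmono (by omega) hf'))
      (by convert N.neg_mem hw using 1; ring)
    have hu1 : u - (f' - (z * w1 - x ^ d * w1)) - z * w1 ∈ N := by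
      convert N.add_mem hw (N.mul_mem_left (x ^ d) hw1') using 1; ring
    obtain ⟨t, ht, ht'⟩ := ih (f' - (z * w1 - x ^ d * w1))
      (Ideal.mem_sup_span_singleton_iff.2 ⟨v - y * w1, by
        convert N.sub_mem hv (N.mul_mem_left y hu1) using 1; ring⟩)
      (Submodule.sub_mem _ hf' (hmono (by omega) (hz _ w1 hw1)))
    obtain ⟨s, hs⟩ := Ideal.mem_sup_span_singleton_iff.1 ht'
    exact ⟨t, ht, Ideal.mem_sup_span_singleton_iff.2 ⟨s + w1, by
      convert N.add_mem hs hu1 using 1; ring⟩⟩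

theorem StrictMod.swap {x y : C} (hy1 : ∀ e, ∀ u ∈ Fil e, y * u ∈ Fil (e + 1))
    (hx : StrictMod Fil N 1 x) (hy : StrictMod Fil (N ⊔ Ideal.span {x}) 1 y) :
    StrictMod Fil (N ⊔ Ideal.span {y}) 1 x := by
  intro e u f hf hu
  obtain ⟨v, hv⟩ := Ideal.mem_sup_span_singleton_iff.1 hu
  obtain ⟨f1, hf1, h1⟩ := hy e v (-f) (Submodule.neg_mem _ hf)
    (Ideal.mem_sup_span_singleton_iff.2 ⟨u, by convert N.neg_mem hv using 1; ring⟩)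
  obtain ⟨v', hv'⟩ := Ideal.mem_sup_span_singleton_iff.1 h1
  obtain ⟨f2, hf2, h2⟩ := hx e (u - y * v') (f + y * f1)
    (Submodule.add_mem _ hf (hy1 e f1 hf1))
    (by convert N.add_mem hv (N.mul_mem_left y hv') using 1; ring)
  exact ⟨f2, hf2, Ideal.mem_sup_span_singleton_iff.2 ⟨v', by convert h2 using 1; ring⟩⟩

include hmono hexh in
-- Passing from `N` to `N + (y)` in the induction requires `x` to be strict modulo `N + (y)`, which
-- is what `StrictMod.swap` provides.
theorem HoldsAlong.sup_of_hasLeadingForm {x z : C} {d : ℕ} {ys : List C}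
    (hx1 : ∀ e, ∀ u ∈ Fil e, x * u ∈ Fil (e + 1))
    (hys1 : ∀ y ∈ ys, ∀ e, ∀ u ∈ Fil e, y * u ∈ Fil (e + 1))
    (hz : HasLeadingForm Fil d (x ^ d) z) (hx : StrictMod Fil N 1 x)
    (hys : HoldsAlong (StrictMod Fil · 1 ·) (N ⊔ Ideal.span {x}) ys) :
    HoldsAlong (StrictMod Fil · 1 ·) (N ⊔ Ideal.span {z}) ys := by
  induction ys generalizing N with
  | nil => trivial
  | cons y ys ih =>
    have hy1 := hys1 y (by simp)
    refine ⟨hx.sup_of_hasLeadingForm hmono hexh hx1 hy1 hys.1 hz, ?_⟩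
    rw [sup_right_comm]
    refine ih (fun t ht => hys1 t (by simp [ht])) (hx.swap hy1 hys.1) ?_
    rw [sup_right_comm]
    exact hys.2

include hmono hexh in
theorem HoldsAlong.of_hasLeadingForm (h0 : Fil 0 = ⊥) {xs zs : List C}
    (hxs1 : ∀ x ∈ xs, ∀ e, ∀ u ∈ Fil e, x * u ∈ Fil (e + 1))
    (hz : List.Forall₂ (fun x z => ∃ d : ℕ, HasLeadingForm Fil d (x ^ d) z) xs zs)
    (hxs : HoldsAlong (StrictMod Fil · 1 ·) N xs) :
    HoldsAlong (fun N z => ∀ u, z * u ∈ N → u ∈ N) N zs := by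
  induction hz generalizing N with
  | nil => trivial
  | @cons x z xs zs hxz _ ih =>
    obtain ⟨d, hd⟩ := hxz
    refine ⟨fun u hu => ?_, ih (fun t ht => hxs1 t (by simp [ht])) ?_⟩
    -- As `Fil 0 = ⊥`, strictness at level 0 with `f = 0` is injectivity modulo `N`.
    · obtain ⟨v, hv, huv⟩ := (hxs.1.pow d).of_hasLeadingForm hmono hexh hd 0 u 0
        (Submodule.zero_mem _) (by simpa using hu)
      rw [h0, Submodule.mem_bot] at hv
      simpa [hv] using huv
    · exact hxs.2.sup_of_hasLeadingForm hmono hexh (hxs1 x (by simp))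
        (fun t ht => hxs1 t (by simp [ht])) hd hxs.1

include hmono in
theorem hasLeadingForm_aeval {x : C} (hx1 : ∀ e, ∀ u ∈ Fil e, x * u ∈ Fil (e + 1))
    {g : Polynomial R} (hg : g.Monic) :
    HasLeadingForm Fil g.natDegree (x ^ g.natDegree) (Polynomial.aeval x g) := by
  have hpow : ∀ (k : ℕ) (e : ℤ), ∀ u ∈ Fil e, x ^ k * u ∈ Fil (e + k) := by
    intro k
    induction k with
    | zero => simp
    | succ k ih =>
      intro e u hu
      have := hx1 _ _ (ih e u hu)
      convert this using 1
      · push_cast; ring_nf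
      · ring
  intro e u hu
  rw [Polynomial.aeval_eq_sum_range, Finset.sum_range_succ, Polynomial.Monic.coeff_natDegree hg,
    one_smul, ← sub_mul, add_sub_cancel_right, Finset.sum_mul]
  refine Submodule.sum_mem _ fun k hk => ?_
  rw [smul_mul_assoc]
  refine Submodule.smul_mem _ _ (hmono ?_ (hpow k e u hu))
  have := Finset.mem_range.1 hk
  omega

end StrictFiltration

/-! ### The fiber ring in coordinates: coefficient ideals and the degree filtration. -/

section ReesCoefficients

open Polynomial

universe u

variable {R : Type u} [CommRing R] (I : Ideal R)

/-- The `R`-linear map `Iʲ → 𝓡` that sends `x` to `x tʲ`. -/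
noncomputable def reesMonomial (j : ℕ) : (I ^ j : Ideal R) →ₗ[R] reesAlgebra I where
  toFun x := ⟨monomial j x.1, reesAlgebra.monomial_mem.2 x.2⟩
  map_add' x y := Subtype.ext (by simp)
  map_smul' c x := Subtype.ext (by simp [smul_monomial])

/-- The `R`-linear map `I → 𝓡` that sends `x` to `x t`. -/
noncomputable def reesDegreeOne : I →ₗ[R] reesAlgebra I where
  toFun x := ⟨monomial 1 x.1, reesAlgebra.monomial_mem.2 (by simp)⟩
  map_add' x y := Subtype.ext (by simp)
  map_smul' c x := Subtype.ext (by simp [smul_monomial])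

variable {I}

@[simp]
theorem coe_reesMonomial (j : ℕ) (x : (I ^ j : Ideal R)) :
    (reesMonomial I j x : R[X]) = monomial j x.1 := rfl

@[simp]
theorem coe_reesDegreeOne (x : I) : (reesDegreeOne I x : R[X]) = monomial 1 x.1 := rfl

theorem reesDegreeOne_mul_reesMonomial {j : ℕ} (a : I) (x : (I ^ j : Ideal R)) :
    reesDegreeOne I a * reesMonomial I j x =
      reesMonomial I (j + 1) ⟨a * x, by rw [pow_succ']; exact Ideal.mul_mem_mul a.2 x.2⟩ :=
  Subtype.ext (by simp [monomial_mul_monomial, add_comm])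

theorem sum_reesMonomial_coeff (p : reesAlgebra I) :
    ∑ j ∈ p.1.support, reesMonomial I j ⟨p.1.coeff j, p.2 j⟩ = p := by
  refine Subtype.ext ?_
  conv_rhs => rw [p.1.as_sum_support]
  simp

variable (I) in
/-- The homogeneous ideal of `𝓡` of the elements whose coefficient of degree `j` is in `b j`. -/
def reesIdeal (b : ℕ → Ideal R) (hb : ∀ j k, I ^ k * b j ≤ b (j + k)) :
    Ideal (reesAlgebra I) where
  carrier := {p | ∀ j, p.1.coeff j ∈ b j}
  add_mem' hp hq j := by simpa using Ideal.add_mem _ (hp j) (hq j)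
  zero_mem' j := by simp
  smul_mem' c p hp j := by
    rw [smul_eq_mul, Subalgebra.coe_mul, coeff_mul]
    refine Ideal.sum_mem _ fun x hx => ?_
    rw [← Finset.HasAntidiagonal.mem_antidiagonal.1 hx, add_comm]
    exact hb _ _ (Ideal.mul_mem_mul (c.2 _) (hp _))

/-- The coefficient ideals of `K𝓡 + (L t)𝓡`. -/
def coeffIdeal (I K L : Ideal R) : ℕ → Ideal R
  | 0 => K
  | j + 1 => L * I ^ j ⊔ K * I ^ (j + 1)

theorem pow_mul_coeffIdeal_le {K L : Ideal R} (j k : ℕ) :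
    I ^ k * coeffIdeal I K L j ≤ coeffIdeal I K L (j + k) := by
  cases j with
  | zero =>
    cases k with
    | zero => simp [coeffIdeal]
    | succ k => rw [zero_add, mul_comm]; exact le_sup_right
  | succ j =>
    rw [show j + 1 + k = j + k + 1 by ring, coeffIdeal, coeffIdeal, Ideal.mul_sup]
    refine sup_le_sup (le_of_eq ?_) (le_of_eq ?_) <;> ring

/-- The ideal is homogeneous, so membership is decided coefficientwise. This is the dictionary
between `𝓡 / K𝓡` and ideals of `R`. -/
theorem mem_map_sup_span_iff {K L : Ideal R} (hL : L ≤ I) (p : reesAlgebra I) :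
    p ∈ K.map (algebraMap R (reesAlgebra I)) ⊔ Ideal.span (reesDegreeOne I '' {x | x.1 ∈ L}) ↔
      ∀ j, p.1.coeff j ∈ coeffIdeal I K L j := by
  set Q := K.map (algebraMap R (reesAlgebra I)) ⊔ Ideal.span (reesDegreeOne I '' {x | x.1 ∈ L})
  constructor
  · suffices Q ≤ reesIdeal I (coeffIdeal I K L) pow_mul_coeffIdeal_le from fun h => this h
    refine sup_le (Ideal.map_le_iff_le_comap.2 fun x hx j => ?_) (Ideal.span_le.2 ?_)
    · change (C x).coeff j ∈ _
      rw [coeff_C]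
      split_ifs with h
      · subst h; exact hx
      · exact Ideal.zero_mem _
    · rintro _ ⟨x, hx, rfl⟩ j
      rw [coe_reesDegreeOne, coeff_monomial]
      split_ifs with h
      · subst h
        exact Ideal.mem_sup_left (by simpa using hx)
      · exact Ideal.zero_mem _
  · intro h
    let W : ℕ → Ideal R := fun j =>
      ((Q.restrictScalars R).comap (reesMonomial I j)).map (Submodule.subtype _)
    have hW : ∀ (j : ℕ) (x : R) (hx : x ∈ I ^ j), reesMonomial I j ⟨x, hx⟩ ∈ Q → x ∈ W j :=
      fun j x hx h => ⟨⟨x, hx⟩, h, rfl⟩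
    have hK : ∀ j, K * I ^ j ≤ W j := fun j => Ideal.mul_le.2 fun k hk y hy => by
      refine hW j _ (Ideal.mul_mem_left _ _ hy) (Ideal.mem_sup_left ?_)
      have h1 := Ideal.mul_mem_right (reesMonomial I j ⟨y, hy⟩) _
        (Ideal.mem_map_of_mem (algebraMap R (reesAlgebra I)) hk)
      convert h1 using 1
      refine Subtype.ext ?_
      rw [Subalgebra.coe_mul, coe_reesMonomial, coe_reesMonomial]
      exact (C_mul_monomial ..).symm
    have hLm : ∀ j, L * I ^ j ≤ W (j + 1) := fun j => Ideal.mul_le.2 fun k hk y hy => by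
      refine hW (j + 1) _ (by rw [pow_succ']; exact Ideal.mul_mem_mul (hL hk) hy)
        (Ideal.mem_sup_right ?_)
      have h1 := Ideal.mul_mem_right (reesMonomial I j ⟨y, hy⟩) _
        (Ideal.subset_span (Set.mem_image_of_mem (reesDegreeOne I)
          (show (⟨k, hL hk⟩ : I) ∈ {x : I | x.1 ∈ L} from hk)))
      rwa [reesDegreeOne_mul_reesMonomial] at h1
    rw [← sum_reesMonomial_coeff p]
    refine Ideal.sum_mem _ fun j _ => ?_
    have hj : p.1.coeff j ∈ W j := by
      have hj := h j
      cases j with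
      | zero => exact hK 0 (by simpa [coeffIdeal] using hj)
      | succ j => exact sup_le (hLm j) (hK (j + 1)) hj
    obtain ⟨x, hx, hxp⟩ := hj
    rwa [show (⟨p.1.coeff j, p.2 j⟩ : (I ^ j : Ideal R)) = x from Subtype.ext hxp.symm]

/-- The ring `𝓡 / K𝓡`, as a type that does not unfold during instance search. -/
def ReesFiber (I K : Ideal R) : Type u := ReesQuotient I K

variable (I) (K : Ideal R)

noncomputable instance : CommRing (ReesFiber I K) :=
  inferInstanceAs (CommRing (ReesQuotient I K))

noncomputable instance : Algebra R (ReesFiber I K) :=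
  inferInstanceAs (Algebra R (ReesQuotient I K))

instance [IsNoetherianRing R] : IsNoetherianRing (ReesFiber I K) :=
  inferInstanceAs (IsNoetherianRing (ReesQuotient I K))

/-- The canonical map `𝓡 → 𝓡 / K𝓡`. -/
noncomputable def ReesFiber.mk : reesAlgebra I →ₐ[R] ReesFiber I K :=
  Ideal.Quotient.mkₐ R (K.map (algebraMap R (reesAlgebra I)))

variable {I} in
theorem ReesFiber.mk_surjective (u : ReesFiber I K) : ∃ p, ReesFiber.mk I K p = u :=
  Ideal.Quotient.mk_surjective u

theorem ReesFiber.ker_mk :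
    RingHom.ker (ReesFiber.mk I K).toRingHom = K.map (algebraMap R (reesAlgebra I)) :=
  Ideal.mk_ker

variable {I}

/-- The class of `x t` in `𝓡 / K𝓡`. -/
noncomputable def fiberDegreeOne (x : I) : ReesFiber I K :=
  ReesFiber.mk I K (reesDegreeOne I x)

/-- The class of `x tʲ` in `𝓡 / K𝓡`. -/
noncomputable def fiberMonomial (j : ℕ) (x : (I ^ j : Ideal R)) : ReesFiber I K :=
  ReesFiber.mk I K (reesMonomial I j x)

theorem fiberDegreeOne_sub (x y : I) :
    fiberDegreeOne K (x - y) = fiberDegreeOne K x - fiberDegreeOne K y := by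
  rw [fiberDegreeOne, map_sub, map_sub]; rfl

theorem fiberDegreeOne_smul (c : R) (x : I) :
    fiberDegreeOne K (c • x) = fiberDegreeOne K x * algebraMap R _ c := by
  rw [fiberDegreeOne, map_smul, map_smul, Algebra.smul_def, mul_comm]; rfl

theorem fiberDegreeOne_zero : fiberDegreeOne K (0 : I) = 0 := by
  rw [fiberDegreeOne, map_zero, map_zero]

variable (I) in
/-- The ideal of `𝓡 / K𝓡` generated by the classes of `x t` with `x ∈ L`. -/
noncomputable def fiberIdeal (L : Ideal R) : Ideal (ReesFiber I K) :=
  Ideal.span (fiberDegreeOne K '' {x : I | x.1 ∈ L})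

variable {K}

theorem mk_mem_fiberIdeal_iff {L : Ideal R} (hL : L ≤ I) (p : reesAlgebra I) :
    ReesFiber.mk I K p ∈ fiberIdeal I K L ↔
      ∀ j, p.1.coeff j ∈ coeffIdeal I K L j := by
  rw [← mem_map_sup_span_iff hL]
  have : fiberIdeal I K L = (Ideal.span (reesDegreeOne I '' {x | x.1 ∈ L})).map
      (ReesFiber.mk I K).toRingHom := by
    rw [fiberIdeal, Ideal.map_span, ← Set.image_comp]; rfl
  rw [this, ← ReesFiber.ker_mk, sup_comm,
    ← Ideal.comap_map_of_surjective' (ReesFiber.mk I K).toRingHom (ReesFiber.mk_surjective K)]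
  rfl

theorem fiberMonomial_mem_fiberIdeal_iff {L : Ideal R} (hL : L ≤ I) {j : ℕ}
    (x : (I ^ j : Ideal R)) :
    fiberMonomial K j x ∈ fiberIdeal I K L ↔ x.1 ∈ coeffIdeal I K L j := by
  refine (mk_mem_fiberIdeal_iff hL _).trans ⟨fun h => by simpa using h j, fun h k => ?_⟩
  rw [coe_reesMonomial, coeff_monomial]
  split_ifs with hk
  · subst hk; exact h
  · exact Ideal.zero_mem _

theorem fiberDegreeOne_mul_fiberMonomial {j : ℕ} (a : I) (x : (I ^ j : Ideal R)) :
    fiberDegreeOne K a * fiberMonomial K j x =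
      fiberMonomial K (j + 1) ⟨a * x, by rw [pow_succ']; exact Ideal.mul_mem_mul a.2 x.2⟩ :=
  by
  rw [fiberDegreeOne, fiberMonomial, ← map_mul, reesDegreeOne_mul_reesMonomial]; rfl

theorem coeff_reesDegreeOne_mul (a : I) (p : reesAlgebra I) (j : ℕ) :
    (reesDegreeOne I a * p).1.coeff (j + 1) = a * p.1.coeff j := by
  rw [Subalgebra.coe_mul, coe_reesDegreeOne, ← C_mul_X_eq_monomial, mul_assoc, coeff_C_mul,
    coeff_X_mul]

variable (I K) in
/-- The filtration of `𝓡 / K𝓡` by degree: `fiberFiltration I K e` consists of the classes of the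
elements of degree less than `e`. -/
noncomputable def fiberFiltration (e : ℤ) : Submodule R (ReesFiber I K) :=
  Submodule.map (ReesFiber.mk I K).toLinearMap
    { carrier := {p : reesAlgebra I | ∀ j : ℕ, e ≤ j → p.1.coeff j = 0}
      add_mem' := fun hp hq j hj => by simp [hp j hj, hq j hj]
      zero_mem' := fun j _ => by simp
      smul_mem' := fun c p hp j hj => by simp [hp j hj] }

theorem fiberFiltration_mono : Monotone (fiberFiltration I K) := by
  rintro e e' h _ ⟨p, hp, rfl⟩
  exact ⟨p, fun j hj => hp j (h.trans hj), rfl⟩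

theorem exists_mem_fiberFiltration (u : ReesFiber I K) : ∃ e, u ∈ fiberFiltration I K e := by
  obtain ⟨p, rfl⟩ := ReesFiber.mk_surjective K u
  exact ⟨p.1.natDegree + 1, p, fun j hj => coeff_eq_zero_of_natDegree_lt (by omega), rfl⟩

theorem fiberFiltration_zero : fiberFiltration I K 0 = ⊥ := by
  refine le_bot_iff.1 ?_
  rintro _ ⟨p, hp, rfl⟩
  have : p = 0 := Subtype.ext (Polynomial.ext fun j => hp j (by simp))
  simp [this]

theorem fiberDegreeOne_mul_mem_fiberFiltration (a : I) (e : ℤ) :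
    ∀ u ∈ fiberFiltration I K e, fiberDegreeOne K a * u ∈ fiberFiltration I K (e + 1) := by
  rintro _ ⟨p, hp, rfl⟩
  refine ⟨reesDegreeOne I a * p, fun j hj => ?_, map_mul (ReesFiber.mk I K) _ _⟩
  cases j with
  | zero =>
    rw [Subalgebra.coe_mul, coe_reesDegreeOne, ← C_mul_X_eq_monomial, mul_assoc, coeff_C_mul,
      coeff_X_mul_zero, mul_zero]
  | succ j => rw [coeff_reesDegreeOne_mul, hp j (by push_cast at hj; omega), mul_zero]

/-- The required representative of `u` is its truncation below degree `e`: in the discarded degrees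
`f` has no coefficients, so `h` applies to each coefficient separately. -/
theorem strictMod_fiberIdeal {L : Ideal R} (hL : L ≤ I) (a : I)
    (h : ∀ j, ∀ x ∈ I ^ j, a * x ∈ coeffIdeal I K L (j + 1) → x ∈ coeffIdeal I K L j) :
    StrictMod (fiberFiltration I K) (fiberIdeal I K L) 1 (fiberDegreeOne K a) := by
  rintro e u _ ⟨q, hq, rfl⟩ hu
  obtain ⟨p, rfl⟩ := ReesFiber.mk_surjective K u
  let v : reesAlgebra I := ∑ j ∈ p.1.support.filter (fun j : ℕ => (j : ℤ) < e),
    reesMonomial I j ⟨p.1.coeff j, p.2 j⟩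
  have hv : ∀ j : ℕ, v.1.coeff j = if (j : ℤ) < e then p.1.coeff j else 0 := by
    intro j
    simp only [v, AddSubmonoidClass.coe_finsetSum, coe_reesMonomial, finsetSum_coeff,
      coeff_monomial, Finset.sum_ite_eq', Finset.mem_filter, mem_support_iff]
    by_cases h0 : p.1.coeff j = 0 <;> simp [h0]
  refine ⟨ReesFiber.mk I K v, ⟨v, fun j hj => ?_, rfl⟩, ?_⟩
  · rw [hv, if_neg (by omega)]
  · rw [← map_sub, mk_mem_fiberIdeal_iff hL]
    intro j
    rw [AddSubgroupClass.coe_sub, coeff_sub, hv]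
    split_ifs with hj
    · simp
    · rw [sub_zero]
      refine h j _ (p.2 j) ?_
      have := (mk_mem_fiberIdeal_iff hL (reesDegreeOne I a * p - q)).1
        (by rwa [map_sub, map_mul]) (j + 1)
      rwa [AddSubgroupClass.coe_sub, coeff_sub, coeff_reesDegreeOne_mul,
        hq (j + 1) (by push_cast; omega), sub_zero] at this

theorem fiberIdeal_sup (L : Ideal R) (a : I) :
    fiberIdeal I K (L ⊔ Ideal.span {a.1}) =
      fiberIdeal I K L ⊔ Ideal.span {fiberDegreeOne K a} := by
  refine le_antisymm (Ideal.span_le.2 ?_) (sup_le (Ideal.span_mono (Set.image_mono ?_)) ?_)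
  · rintro _ ⟨x, hx, rfl⟩
    obtain ⟨w, hw⟩ := Ideal.mem_sup_span_singleton_iff.1 hx
    have hmem : fiberDegreeOne K (x - w • a) ∈ fiberIdeal I K L :=
      Ideal.subset_span ⟨x - w • a, by simpa [mul_comm] using hw, rfl⟩
    rw [fiberDegreeOne_sub, fiberDegreeOne_smul] at hmem
    exact (Ideal.mem_sup_span_singleton_iff (N := fiberIdeal I K L) (x := fiberDegreeOne K a)
      (a := fiberDegreeOne K x)).2 ⟨algebraMap R _ w, hmem⟩
  · exact fun x hx => Ideal.mem_sup_left hx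
  · rw [Ideal.span_singleton_le_iff_mem]
    exact Ideal.subset_span ⟨a, Ideal.mem_sup_right (Ideal.mem_span_singleton_self _), rfl⟩

theorem fiberIdeal_bot : fiberIdeal I K ⊥ = ⊥ := by
  rw [fiberIdeal, Ideal.span_eq_bot]
  rintro _ ⟨x, hx, rfl⟩
  rw [show x = 0 from Subtype.ext hx, fiberDegreeOne_zero]

theorem fiberDegreeOne_pow (x : I) (n : ℕ) :
    fiberDegreeOne K x ^ n = fiberMonomial K n ⟨x.1 ^ n, Ideal.pow_mem_pow x.2 n⟩ := by
  rw [fiberDegreeOne, fiberMonomial, ← map_pow]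
  refine congrArg _ (Subtype.ext ?_)
  rw [SubmonoidClass.coe_pow, coe_reesDegreeOne, coe_reesMonomial, monomial_pow, one_mul]

theorem fiberMonomial_mem_fiberIdeal_pow {J : Ideal R} (hJ : J ≤ I) (n : ℕ) {x : R}
    (hx : x ∈ J ^ n) :
    fiberMonomial K n ⟨x, Ideal.pow_right_mono hJ n hx⟩ ∈ fiberIdeal I K J ^ n := by
  revert x
  suffices J ^ n ≤ (((fiberIdeal I K J ^ n).restrictScalars R).comap
      ((ReesFiber.mk I K).toLinearMap ∘ₗ reesMonomial I n)).map (Submodule.subtype _) by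
    intro x hx
    obtain ⟨y, hy, rfl⟩ := this hx
    exact hy
  induction n with
  | zero =>
    intro y _
    refine ⟨⟨y, by simp⟩, ?_, rfl⟩
    simp
  | succ n ih =>
    rw [pow_succ', Ideal.mul_le]
    intro a ha y hy
    obtain ⟨⟨y, hy1⟩, hy2, rfl⟩ := ih hy
    refine ⟨⟨a * y, by rw [pow_succ']; exact Ideal.mul_mem_mul (hJ ha) hy1⟩, ?_, rfl⟩
    have := Ideal.mul_mem_mul (Ideal.subset_span (Set.mem_image_of_mem (fiberDegreeOne K)
      (show (⟨a, hJ ha⟩ : I) ∈ {x : I | x.1 ∈ J} from ha)) ) hy2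
    rw [← fiberIdeal, ← pow_succ'] at this
    change fiberMonomial K (n + 1) _ ∈ fiberIdeal I K J ^ (n + 1)
    rwa [← fiberDegreeOne_mul_fiberMonomial (K := K) ⟨a, hJ ha⟩ ⟨y, hy1⟩]

theorem IsReduction.pow_add {J : Ideal R} {n : ℕ} (h : I ^ (n + 1) = J * I ^ n) (k : ℕ) :
    I ^ (n + k) = J ^ k * I ^ n := by
  induction k with
  | zero => simp
  | succ k ih =>
    rw [← add_assoc, pow_succ, ih, mul_assoc, ← pow_succ, h, ← mul_assoc, ← pow_succ]

end ReesCoefficients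

/-! ### Reductions with as many generators as the height of the homogeneous maximal ideal. -/

section AnalyticSpread

open Polynomial IsLocalRing

universe u

variable {R : Type u} [CommRing R] [IsLocalRing R]

/-- By Nakayama the submodules stay proper in `M/𝔪M`, and a vector space over an infinite field is
not a finite union of proper subspaces. -/
theorem exists_forall_notMem_of_forall_ne_top_of_infinite_residueField
    [Infinite (ResidueField R)] {M : Type*} [AddCommGroup M] [Module R M] [Module.Finite R M]
    {ι : Type*} [Finite ι] (p : ι → Submodule R M) (hp : ∀ i, p i ≠ ⊤) : ∃ x, ∀ i, x ∉ p i := by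
  let _ : Field (R ⧸ maximalIdeal R) := Ideal.Quotient.field _
  have : Infinite (R ⧸ maximalIdeal R) := ‹Infinite (ResidueField R)›
  let W : Submodule R M := maximalIdeal R • ⊤
  let q : ι → Submodule (R ⧸ maximalIdeal R) (M ⧸ W) := fun i =>
    { carrier := (p i).map W.mkQ
      add_mem' := fun ha hb => Submodule.add_mem _ ha hb
      zero_mem' := Submodule.zero_mem _
      smul_mem' := fun c x hx => by
        obtain ⟨c, rfl⟩ := Ideal.Quotient.mk_surjective c
        exact Submodule.smul_mem ((p i).map W.mkQ) c hx }
  obtain ⟨x, hx⟩ := Submodule.exists_forall_notMem_of_forall_ne_top q fun i hi => hp i <| by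
    refine top_le_iff.1 (Submodule.le_of_le_smul_of_le_jacobson_bot (I := maximalIdeal R)
      Module.Finite.fg_top ?_ fun x _ => ?_)
    · rw [IsLocalRing.jacobson_eq_maximalIdeal _ bot_ne_top]
    · have : W.mkQ x ∈ q i := hi ▸ Submodule.mem_top
      obtain ⟨y, hy, hxy⟩ := this
      have h2 : x - y ∈ W := by
        rw [← Submodule.Quotient.mk_eq_zero, ← Submodule.mkQ_apply, map_sub, hxy, sub_self]
      exact Submodule.mem_sup.2 ⟨y, hy, x - y, h2, by abel⟩
  obtain ⟨x, rfl⟩ := W.mkQ_surjective x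
  exact ⟨x, fun i hi => hx i ⟨x, hi, rfl⟩⟩

variable {I K : Ideal R}

/-- The map from `𝓡 / K𝓡` to the residue field of `R` that kills the elements of positive degree. -/
noncomputable def fiberResidue (I : Ideal R) (hK : K ≤ maximalIdeal R) :
    ReesFiber I K →+* ResidueField R :=
  Ideal.Quotient.lift (K.map (algebraMap R (reesAlgebra I)))
    ((residue R).comp ((constantCoeff (R := R)).comp (reesAlgebra I).val.toRingHom)) <| by
      intro x hx
      rw [← RingHom.mem_ker]
      revert x
      change K.map _ ≤ _
      rw [Ideal.map_le_iff_le_comap]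
      intro k hk
      change residue R ((C k).coeff 0) = 0
      rw [coeff_C_zero, residue_eq_zero_iff]
      exact hK hk

theorem fiberResidue_mk (hK : K ≤ maximalIdeal R) (p : reesAlgebra I) :
    fiberResidue I hK (ReesFiber.mk I K p) = residue R (p.1.coeff 0) := rfl

/-- The maximal homogeneous ideal of `𝓡 / K𝓡`. -/
noncomputable def fiberMaximal (I : Ideal R) (hK : K ≤ maximalIdeal R) : Ideal (ReesFiber I K) :=
  RingHom.ker (fiberResidue I hK)

instance (hK : K ≤ maximalIdeal R) : (fiberMaximal I hK).IsMaximal :=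
  RingHom.ker_isMaximal_of_surjective _ fun z => by
    obtain ⟨c, rfl⟩ := residue_surjective z
    refine ⟨ReesFiber.mk I K (algebraMap R _ c), ?_⟩
    rw [fiberResidue_mk]
    exact congrArg _ coeff_C_zero

theorem mk_mem_fiberMaximal_iff (hK : K ≤ maximalIdeal R) (p : reesAlgebra I) :
    ReesFiber.mk I K p ∈ fiberMaximal I hK ↔ p.1.coeff 0 ∈ maximalIdeal R := by
  rw [fiberMaximal, RingHom.mem_ker, fiberResidue_mk, residue_eq_zero_iff]

theorem fiberDegreeOne_mem_fiberMaximal (hK : K ≤ maximalIdeal R) (x : I) :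
    fiberDegreeOne K x ∈ fiberMaximal I hK := by
  refine (mk_mem_fiberMaximal_iff hK _).2 ?_
  rw [coe_reesDegreeOne, coeff_monomial, if_neg one_ne_zero]
  exact Ideal.zero_mem _

theorem fiberIdeal_le_fiberMaximal (hK : K ≤ maximalIdeal R) (L : Ideal R) :
    fiberIdeal I K L ≤ fiberMaximal I hK := by
  refine Ideal.span_le.2 ?_
  rintro _ ⟨x, -, rfl⟩
  exact fiberDegreeOne_mem_fiberMaximal hK x

/-- The degree `j` coefficient of the product is `x` times the constant coefficient of a lift of
`s`, which is a unit. This undoes localization at `fiberMaximal` on homogeneous elements. -/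
theorem fiberMonomial_mem_of_mul_mem (hK : K ≤ maximalIdeal R) {L : Ideal R} (hL : L ≤ I)
    {s : ReesFiber I K} (hs : s ∉ fiberMaximal I hK) {j : ℕ} (x : (I ^ j : Ideal R))
    (h : s * fiberMonomial K j x ∈ fiberIdeal I K L) : x.1 ∈ coeffIdeal I K L j := by
  obtain ⟨p, rfl⟩ := ReesFiber.mk_surjective K s
  rw [mk_mem_fiberMaximal_iff, mem_maximalIdeal, mem_nonunits_iff, not_not] at hs
  rw [fiberMonomial, ← map_mul, mk_mem_fiberIdeal_iff hL] at h
  have h1 := h j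
  rw [Subalgebra.coe_mul, coe_reesMonomial] at h1
  have h2 : (p.1 * monomial j x.1).coeff j = p.1.coeff 0 * x.1 := by
    simpa using coeff_mul_monomial p.1 j 0 x.1
  rw [h2] at h1
  exact (Ideal.unit_mul_mem_iff_mem _ hs).1 h1

variable [IsNoetherianRing R]

/-- Each new element of `J` is chosen so that its class in degree one avoids every minimal prime
over the previous ones that does not contain `Jt`. -/
theorem exists_height_le_of_fiberIdeal_le [Infinite (ResidueField R)] {J : Ideal R} (hJ : J ≤ I)
    (i : ℕ) : ∃ b : Fin i → R, (∀ s, b s ∈ J) ∧ ∀ P : Ideal (ReesFiber I K), P.IsPrime →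
      fiberIdeal I K (Ideal.span (Set.range b)) ≤ P → ¬ fiberIdeal I K J ≤ P →
        (i : ℕ∞) ≤ P.height := by
  induction i with
  | zero => exact ⟨Fin.elim0, fun s => s.elim0, fun P _ _ _ => by simp⟩
  | succ i ih =>
    obtain ⟨b, hb, h⟩ := ih
    set Q := fiberIdeal I K (Ideal.span (Set.range b)) with hQ
    let T := {P ∈ Q.minimalPrimes | ¬ fiberIdeal I K J ≤ P}
    have hT : Finite T := (Q.finite_minimalPrimes_of_isNoetherianRing.subset
      (Set.sep_subset _ _)).to_subtype
    let p : T → Submodule R J := fun P => (P.1.restrictScalars R).comap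
      ((ReesFiber.mk I K).toLinearMap ∘ₗ reesDegreeOne I ∘ₗ Submodule.inclusion hJ)
    obtain ⟨v, hv⟩ := exists_forall_notMem_of_forall_ne_top_of_infinite_residueField p <| by
      rintro ⟨P, hP, hJP⟩ htop
      refine hJP (Ideal.span_le.2 ?_)
      rintro _ ⟨x, hx, rfl⟩
      have : (⟨x.1, hx⟩ : J) ∈ p ⟨P, hP, hJP⟩ := htop ▸ Submodule.mem_top
      exact this
    refine ⟨Fin.snoc b v.1, fun s => ?_, fun P hP hle hJP => ?_⟩
    · induction s using Fin.lastCases with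
      | last => simp
      | cast s => simpa using hb s
    · rw [Fin.range_snoc, Set.insert_eq, Ideal.span_union, sup_comm,
        fiberIdeal_sup _ ⟨v.1, hJ v.2⟩] at hle
      obtain ⟨P', hP', hP'P⟩ := Ideal.exists_minimalPrimes_le (le_sup_left.trans hle)
      have hJP' : ¬ fiberIdeal I K J ≤ P' := fun h => hJP (h.trans hP'P)
      have hlt : P' < P := lt_of_le_of_ne hP'P fun heq => hv ⟨P', hP', hJP'⟩ <| by
        change fiberDegreeOne K ⟨v.1, hJ v.2⟩ ∈ P'
        rw [heq]
        exact hle (Ideal.mem_sup_right (Ideal.mem_span_singleton_self _))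
      have := hP'.1.1
      push_cast
      exact (add_le_add_left (h P' hP'.1.1 hP'.1.2 hJP') 1).trans
        (Ideal.height_add_one_le_of_lt_of_isPrime hlt)

theorem pow_le_of_le_sup_maximalIdeal_mul {L : Ideal R} {A : Ideal R}
    (h : A ≤ L ⊔ maximalIdeal R * A) : A ≤ L := by
  refine Submodule.le_of_le_smul_of_le_jacobson_bot (IsNoetherian.noetherian A) ?_ h
  rw [IsLocalRing.jacobson_eq_maximalIdeal _ bot_ne_top]

/-- A prime inside `fiberMaximal` that contains `Lt` but not `Jt` would have height at least `d` and
lie strictly below an ideal of height `d`. Hence `Jt` is in the radical of `Lt`, that is, `J^(N+1) ⊆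
L I^N + K I^(N+1)`, and Nakayama makes `L` a reduction. -/
theorem IsReduction.exists_fin_of_height_eq [Infinite (ResidueField R)] {J : Ideal R}
    (hJ : IsReduction J I) (hK : K ≤ maximalIdeal R) {d : ℕ} (hd : (fiberMaximal I hK).height = d) :
    ∃ b : Fin d → R, (∀ s, b s ∈ J) ∧ IsReduction (Ideal.span (Set.range b)) I := by
  obtain ⟨hJI, n, hn⟩ := hJ
  obtain ⟨b, hb, hht⟩ := exists_height_le_of_fiberIdeal_le (K := K) hJI d
  set L := Ideal.span (Set.range b) with hLdef
  have hLJ : L ≤ J := Ideal.span_le.2 (Set.range_subset_iff.2 hb)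
  have hLI := hLJ.trans hJI
  refine ⟨b, hb, hLI, ?_⟩
  have hprime : ∀ P : Ideal (ReesFiber I K), P.IsPrime → fiberIdeal I K L ≤ P →
      P ≤ fiberMaximal I hK → fiberIdeal I K J ≤ P := by
    intro P hP hLP hPM
    by_contra hJP
    have hlt : P < fiberMaximal I hK := lt_of_le_of_ne hPM fun h =>
      hJP (h ▸ fiberIdeal_le_fiberMaximal hK J)
    have h1 := (add_le_add_left (hht P hP hLP hJP) 1).trans
      (Ideal.height_add_one_le_of_lt_of_isPrime hlt)
    rw [hd] at h1
    norm_cast at h1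
    omega
  have hrad : fiberIdeal I K J ≤ (fiberIdeal I K L).radical := by
    refine Ideal.span_le.2 ?_
    rintro _ ⟨x, hx, rfl⟩
    have hex : ∃ s ∉ fiberMaximal I hK, ∃ m : ℕ,
        s * fiberDegreeOne K x ^ m ∈ fiberIdeal I K L := by
      by_contra! hcon
      obtain ⟨P, hP, hLP, hdisj⟩ := Ideal.exists_le_prime_disjoint (fiberIdeal I K L)
        ((fiberMaximal I hK).primeCompl ⊔ Submonoid.powers (fiberDegreeOne K x)) <| by
          rw [Set.disjoint_left]
          intro y hy hy'
          obtain ⟨s, hs, _, ⟨m, rfl⟩, rfl⟩ := Submonoid.mem_sup.1 hy'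
          exact hcon s hs m hy
      rw [Set.disjoint_left] at hdisj
      have hPM : P ≤ fiberMaximal I hK := fun y hy => by
        by_contra hyM
        exact hdisj hy (Submonoid.mem_sup_left (show y ∈ (fiberMaximal I hK).primeCompl from hyM))
      exact hdisj (hprime P hP hLP hPM (Ideal.subset_span ⟨x, hx, rfl⟩))
        (Submonoid.mem_sup_right (Submonoid.mem_powers _))
    obtain ⟨s, hs, m, hm⟩ := hex
    refine ⟨m, ?_⟩
    rw [fiberDegreeOne_pow] at hm ⊢
    exact (fiberMonomial_mem_fiberIdeal_iff hLI _).2 (fiberMonomial_mem_of_mul_mem hK hLI hs _ hm)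
  obtain ⟨N, hN⟩ := Ideal.exists_pow_le_of_le_radical_of_fg hrad (IsNoetherian.noetherian _)
  have hle : J ^ (N + 1) ≤ L * I ^ N ⊔ K * I ^ (N + 1) := fun x hx =>
    (fiberMonomial_mem_fiberIdeal_iff (K := K) hLI (j := N + 1) _).1
      (hN (Ideal.pow_le_pow_right N.le_succ (fiberMonomial_mem_fiberIdeal_pow hJI (N + 1) hx)))
  refine ⟨n + N, le_antisymm (pow_le_of_le_sup_maximalIdeal_mul ?_) ?_⟩
  · have h1 := IsReduction.pow_add hn (N + 1)
    rw [← add_assoc] at h1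
    calc I ^ (n + N + 1) = J ^ (N + 1) * I ^ n := h1
      _ ≤ (L * I ^ N ⊔ K * I ^ (N + 1)) * I ^ n := Ideal.mul_mono_left hle
      _ = L * I ^ (n + N) ⊔ K * I ^ (n + N + 1) := by rw [Ideal.sup_mul]; congr 1 <;> ring
      _ ≤ _ := sup_le_sup le_rfl (Ideal.mul_mono_left hK)
  · rw [pow_succ']
    exact Ideal.mul_mono_left hLI

end AnalyticSpread

/-! ### Dimension of the fiber ring, analytic spread and minimal reductions. -/

section FiberDimension

open IsLocalRing

universe u

theorem ringKrullDim_le_of_isIntegral (A B : Type*) [CommRing A] [CommRing B] [Algebra A B]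
    [Algebra.IsIntegral A B] : ringKrullDim B ≤ ringKrullDim A :=
  Order.krullDim_le_of_strictMono (PrimeSpectrum.comap (algebraMap A B)) fun _ _ h =>
    Ideal.IsIntegral.comap_lt_comap h

variable {R : Type u} [CommRing R]

theorem ringKrullDim_quotient_le_zero [IsLocalRing R] {K : Ideal R}
    (hK : K.radical = maximalIdeal R) : ringKrullDim (R ⧸ K) ≤ 0 := by
  have : Ring.KrullDimLE 0 (R ⧸ K) := by
    refine Ring.KrullDimLE.mk₀ fun q hq => ?_
    have hcm : maximalIdeal R ≤ q.comap (Ideal.Quotient.mk _) := by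
      rw [← hK]
      refine (Ideal.IsPrime.radical_le_iff inferInstance).2 fun z hz => ?_
      rw [Ideal.mem_comap, Ideal.Quotient.eq_zero_iff_mem.2 hz]
      exact q.zero_mem
    have hmx : (q.comap (Ideal.Quotient.mk K)).IsMaximal := by
      have := (IsLocalRing.maximalIdeal.isMaximal R).eq_of_le
        (Ideal.IsPrime.ne_top inferInstance) hcm
      rw [← this]; infer_instance
    exact Ideal.map_comap_of_surjective _ Ideal.Quotient.mk_surjective q ▸
      (Ideal.map_eq_top_or_isMaximal_of_surjective _ Ideal.Quotient.mk_surjective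
          hmx).resolve_left
        (by rw [Ideal.map_comap_of_surjective _ Ideal.Quotient.mk_surjective]; exact hq.ne_top)
  simpa [Ring.KrullDimLE, Order.krullDimLE_iff, ringKrullDim] using this

variable {I K : Ideal R} {d : ℕ}

variable (K) in
/-- The map `(R / K)[T₁, …, T_d] → 𝓡 / K𝓡` that sends `Tᵢ` to `bᵢ t`. -/
noncomputable def fiberPresentation (b : Fin d → R) (hb : ∀ s, b s ∈ I) :
    MvPolynomial (Fin d) (R ⧸ K) →+* ReesFiber I K :=
  MvPolynomial.eval₂Hom (Ideal.Quotient.lift K (algebraMap R (ReesFiber I K)) fun _ hk =>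
      Ideal.Quotient.eq_zero_iff_mem.2 (Ideal.mem_map_of_mem (algebraMap R (reesAlgebra I)) hk))
    fun s => fiberDegreeOne K ⟨b s, hb s⟩

/-- Beyond degree `n` each graded piece is the ideal `(b)` times the previous one, so the pieces of
degree at most `n` generate. -/
theorem finite_fiberPresentation [IsNoetherianRing R] (b : Fin d → R) (hb : ∀ s, b s ∈ I)
    (hred : IsReduction (Ideal.span (Set.range b)) I) : (fiberPresentation K b hb).Finite := by
  let _ : Algebra (MvPolynomial (Fin d) (R ⧸ K)) (ReesFiber I K) :=
    (fiberPresentation K b hb).toAlgebra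
  have : IsScalarTower R (MvPolynomial (Fin d) (R ⧸ K)) (ReesFiber I K) := by
    refine IsScalarTower.of_algebraMap_eq fun c => ?_
    change _ = MvPolynomial.eval₂Hom _ _ (MvPolynomial.C (Ideal.Quotient.mk K c))
    rw [MvPolynomial.coe_eval₂Hom, MvPolynomial.eval₂_C]
    rfl
  obtain ⟨-, n, hn⟩ := hred
  let N : Submodule R (ReesFiber I K) :=
    ⨆ j : Fin (n + 1), LinearMap.range ((ReesFiber.mk I K).toLinearMap ∘ₗ reesMonomial I j)
  have hN : N.FG := Submodule.fg_iSup _ fun j => (LinearMap.range_eq_map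
    ((ReesFiber.mk I K).toLinearMap ∘ₗ reesMonomial I j)) ▸
      (IsNoetherian.noetherian (⊤ : Submodule R (I ^ (j : ℕ) : Ideal R))).map _
  let Q : Submodule (MvPolynomial (Fin d) (R ⧸ K)) (ReesFiber I K) := Submodule.span _ (N : Set _)
  have hQ : Q.FG := by
    obtain ⟨t, ht⟩ := hN
    exact ⟨t, by rw [← Submodule.span_span_of_tower R, ht]⟩
  have hX : ∀ (s : Fin d) (u : ReesFiber I K), u ∈ Q → fiberDegreeOne K ⟨b s, hb s⟩ * u ∈ Q := by
    intro s u hu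
    have h1 := Q.smul_mem (MvPolynomial.X s) hu
    have h2 : algebraMap (MvPolynomial (Fin d) (R ⧸ K)) (ReesFiber I K) (MvPolynomial.X s) =
        fiberDegreeOne K ⟨b s, hb s⟩ := MvPolynomial.eval₂_X _ _ _
    rwa [Algebra.smul_def, h2] at h1
  have hmon : ∀ j, ∀ x : (I ^ j : Ideal R), fiberMonomial K j x ∈ Q := by
    intro j
    induction j with
    | zero =>
      exact fun x => Submodule.subset_span (Submodule.mem_iSup_of_mem (0 : Fin (n + 1)) ⟨x, rfl⟩)
    | succ j ih =>
      intro x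
      by_cases hj : j + 1 ≤ n
      · exact Submodule.subset_span (Submodule.mem_iSup_of_mem
          (⟨j + 1, by omega⟩ : Fin (n + 1)) ⟨x, rfl⟩)
      · have hpow : I ^ (j + 1) = Ideal.span (Set.range b) * I ^ j := by
          obtain ⟨k, rfl⟩ : ∃ k, j = n + k := ⟨j - n, by omega⟩
          rw [add_assoc, IsReduction.pow_add hn, IsReduction.pow_add hn, pow_succ', mul_assoc]
        suffices Ideal.span (Set.range b) * I ^ j ≤ ((Q.restrictScalars R).comap
            ((ReesFiber.mk I K).toLinearMap ∘ₗ reesMonomial I (j + 1))).map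
              (Submodule.subtype _) by
          obtain ⟨y, hy, hyx⟩ := this (hpow.le x.2)
          rw [← show y = x from Subtype.ext hyx]
          exact hy
        rw [Ideal.mul_le]
        intro l hl y hy
        induction hl using Submodule.span_induction with
        | mem l hl =>
          obtain ⟨s, rfl⟩ := hl
          refine ⟨⟨b s * y, by rw [pow_succ']; exact Ideal.mul_mem_mul (hb s) hy⟩, ?_, rfl⟩
          have h1 := hX s _ (ih ⟨y, hy⟩)
          rwa [fiberDegreeOne_mul_fiberMonomial] at h1
        | zero => rw [zero_mul]; exact Submodule.zero_mem _
        | add l l' _ _ h h' => rw [add_mul]; exact Submodule.add_mem _ h h'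
        | smul c l _ h => rw [smul_mul_assoc]; exact Submodule.smul_mem _ c h
  refine ⟨?_⟩
  suffices h : ∀ u, u ∈ Q by
    rwa [← Submodule.eq_top_iff'.2 h]
  intro u
  obtain ⟨p, rfl⟩ := ReesFiber.mk_surjective K u
  rw [← sum_reesMonomial_coeff p, map_sum]
  exact Submodule.sum_mem _ fun j _ => hmon j _

theorem isReduction_self (I : Ideal R) : IsReduction I I := ⟨le_rfl, 0, by simp⟩

variable [IsLocalRing R]

theorem le_maximalIdeal_of_radical_eq (hK : K.radical = maximalIdeal R) : K ≤ maximalIdeal R :=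
  hK ▸ Ideal.le_radical

variable [IsNoetherianRing R]

theorem ringKrullDim_reesFiber_le (hK : K.radical = maximalIdeal R) (b : Fin d → R)
    (hred : IsReduction (Ideal.span (Set.range b)) I) : ringKrullDim (ReesFiber I K) ≤ d := by
  have hb : ∀ s, b s ∈ I := fun s => hred.1 (Ideal.subset_span ⟨s, rfl⟩)
  let _ : Algebra (MvPolynomial (Fin d) (R ⧸ K)) (ReesFiber I K) :=
    (fiberPresentation K b hb).toAlgebra
  have : Module.Finite (MvPolynomial (Fin d) (R ⧸ K)) (ReesFiber I K) :=
    finite_fiberPresentation b hb hred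
  refine (ringKrullDim_le_of_isIntegral (MvPolynomial (Fin d) (R ⧸ K)) _).trans ?_
  rw [MvPolynomial.ringKrullDim_of_isNoetherianRing, Nat.card_eq_fintype_card, Fintype.card_fin]
  calc _ ≤ (0 : WithBot ℕ∞) + d := add_le_add_left (ringKrullDim_quotient_le_zero hK) _
    _ = d := zero_add _

variable {ℓ : ℕ} (hℓ : analyticSpread I = ℓ)

include hℓ in
theorem IsReduction.analyticSpread_le {b : Fin d → R}
    (hred : IsReduction (Ideal.span (Set.range b)) I) : ℓ ≤ d := by
  have h := ringKrullDim_reesFiber_le (K := maximalIdeal R)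
    (Ideal.IsPrime.radical inferInstance) b hred
  have h' : ringKrullDim (ReesFiber I (maximalIdeal R)) = ℓ := hℓ
  rw [h'] at h
  exact_mod_cast h

include hℓ in
-- If `c s` were a unit, `b s` would be redundant modulo `𝔪I`, and by Nakayama the other `ℓ - 1`
-- elements would generate a reduction, fewer than the analytic spread allows.
theorem IsReduction.coeff_mem_maximalIdeal {b c : Fin ℓ → R}
    (hred : IsReduction (Ideal.span (Set.range b)) I)
    (h : ∑ s, c s * b s ∈ maximalIdeal R * I) (s : Fin ℓ) : c s ∈ maximalIdeal R := by
  by_contra hs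
  obtain ⟨ℓ, rfl⟩ : ∃ m, ℓ = m + 1 := ⟨ℓ - 1, by have := s.pos; omega⟩
  let L := Ideal.span (Set.range (b ∘ s.succAbove))
  have hLI : L ≤ I := (Ideal.span_mono (Set.range_comp_subset_range _ _)).trans hred.1
  have hsL : b s ∈ L ⊔ maximalIdeal R * I := by
    rw [mem_maximalIdeal, mem_nonunits_iff, not_not] at hs
    rw [← Ideal.unit_mul_mem_iff_mem _ hs]
    rw [Fin.sum_univ_succAbove _ s] at h
    refine (Submodule.add_mem_iff_left _ ?_).1 (Ideal.mem_sup_right h)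
    exact Ideal.mem_sup_left <| Ideal.sum_mem _ fun t _ =>
      Ideal.mul_mem_left _ _ (Ideal.subset_span ⟨t, rfl⟩)
  have hle : Ideal.span (Set.range b) ≤ L ⊔ maximalIdeal R * I := by
    rw [Ideal.span_le]
    rintro _ ⟨t, rfl⟩
    rcases eq_or_ne t s with rfl | hts
    · exact hsL
    · obtain ⟨t, rfl⟩ := Fin.exists_succAbove_eq hts
      exact Ideal.mem_sup_left (Ideal.subset_span ⟨t, rfl⟩)
  obtain ⟨-, n, hn⟩ := hred
  have : IsReduction L I := by
    refine ⟨hLI, n, le_antisymm (pow_le_of_le_sup_maximalIdeal_mul ?_) ?_⟩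
    · calc I ^ (n + 1) = Ideal.span (Set.range b) * I ^ n := hn
        _ ≤ (L ⊔ maximalIdeal R * I) * I ^ n := Ideal.mul_mono_left hle
        _ = _ := by rw [Ideal.sup_mul, mul_assoc, ← pow_succ']
    · rw [pow_succ']; exact Ideal.mul_mono_left hLI
  have := this.analyticSpread_le hℓ
  omega

variable [Infinite (ResidueField R)]

include hℓ in
-- Let `d` and `e` be the heights for `K` and for `𝔪`. Each is the number of generators of some
-- reduction, and that number bounds the dimension of every such fiber ring: `ℓ ≤ d ≤ dim 𝓡/K𝓡 ≤ e ≤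
-- ℓ`.
theorem height_fiberMaximal (hK : K.radical = maximalIdeal R) :
    (fiberMaximal I (le_maximalIdeal_of_radical_eq hK)).height = ℓ := by
  have key : ∀ {K : Ideal R} (hK : K ≤ maximalIdeal R), ∃ d : ℕ, (fiberMaximal I hK).height = d ∧
      ∃ b : Fin d → R, IsReduction (Ideal.span (Set.range b)) I := by
    intro K hK
    obtain ⟨d, hd⟩ := ENat.ne_top_iff_exists.1
      (Ideal.height_ne_top_of_isPrime (I := fiberMaximal I hK))
    obtain ⟨b, -, hb⟩ := (isReduction_self I).exists_fin_of_height_eq hK hd.symm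
    exact ⟨d, hd.symm, b, hb⟩
  obtain ⟨e, he, b, hb⟩ := key (le_refl (maximalIdeal R))
  obtain ⟨d, hd, b', hb'⟩ := key (le_maximalIdeal_of_radical_eq hK)
  have h' : ringKrullDim (ReesFiber I (maximalIdeal R)) = ℓ := hℓ
  have h1 : e ≤ ℓ := by
    have := Ideal.height_le_ringKrullDim_of_isPrime (I := fiberMaximal I (le_refl (maximalIdeal R)))
    rw [he, h'] at this
    exact_mod_cast this
  have h2 : d ≤ e := by
    have h3 := ringKrullDim_reesFiber_le hK b hb
    have := (Ideal.height_le_ringKrullDim_of_isPrime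
      (I := fiberMaximal I (le_maximalIdeal_of_radical_eq hK))).trans h3
    rw [hd] at this
    exact_mod_cast this
  have h3 := hb'.analyticSpread_le hℓ
  rw [hd]
  exact_mod_cast le_antisymm (h2.trans h1) h3

include hℓ in
theorem ringKrullDim_reesFiber (hK : K.radical = maximalIdeal R) :
    ringKrullDim (ReesFiber I K) = ℓ := by
  have h1 := height_fiberMaximal hℓ (Ideal.IsPrime.radical (I := maximalIdeal R) inferInstance)
  obtain ⟨b, -, hb⟩ := (isReduction_self I).exists_fin_of_height_eq _ h1
  refine le_antisymm (ringKrullDim_reesFiber_le hK b hb) ?_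
  have h2 := Ideal.height_le_ringKrullDim_of_isPrime
    (I := fiberMaximal I (le_maximalIdeal_of_radical_eq hK))
  rwa [height_fiberMaximal hℓ hK] at h2

include hℓ in
theorem IsReduction.exists_fin {J : Ideal R} (hJ : IsReduction J I) :
    ∃ b : Fin ℓ → R, (∀ s, b s ∈ J) ∧ IsReduction (Ideal.span (Set.range b)) I :=
  hJ.exists_fin_of_height_eq _
    (height_fiberMaximal hℓ (Ideal.IsPrime.radical (I := maximalIdeal R) inferInstance))

include hℓ in
theorem IsReduction.isMinimalReduction {a : Fin ℓ → R}
    (hred : IsReduction (Ideal.span (Set.range a)) I) :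
    IsMinimalReduction (Ideal.span (Set.range a)) I := by
  refine ⟨hred, fun J' hJ' hle => ?_⟩
  obtain ⟨b, hbJ, hb⟩ := hJ'.exists_fin hℓ
  have hc : ∀ s, ∃ c : Fin ℓ → R, ∑ t, c t * a t = b s := fun s =>
    Ideal.mem_span_range_iff_exists_fun.1 (hle (hbJ s))
  choose c hc using hc
  let M : Matrix (Fin ℓ) (Fin ℓ) R := Matrix.of c
  have hMa : M.mulVec a = b := funext hc
  -- Otherwise a left kernel vector of `M` modulo `𝔪` lifts to a combination of the `b s` in `𝔪I`
  -- whose coefficients are not all in `𝔪`.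
  have hdet : IsUnit M.det := by
    by_contra hdet
    have hdet0 : (M.map (residue R)).det = 0 := by
      rw [← RingHom.mapMatrix_apply, ← RingHom.map_det, residue_eq_zero_iff]
      exact hdet
    obtain ⟨v, hv0, hv⟩ := Matrix.exists_vecMul_eq_zero_iff.2 hdet0
    choose w hw using fun s => residue_surjective (v s)
    refine hv0 (funext fun s => ?_)
    rw [← hw s, Pi.zero_apply, residue_eq_zero_iff]
    refine hb.coeff_mem_maximalIdeal hℓ (c := w) ?_ s
    have : ∑ s, w s * b s = ∑ t, (Matrix.vecMul w M t) * a t := by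
      have := Matrix.dotProduct_mulVec w M a
      rw [hMa] at this
      exact this
    rw [this]
    refine Ideal.sum_mem _ fun t _ => Ideal.mul_mem_mul ?_ (hred.1 (Ideal.subset_span ⟨t, rfl⟩))
    rw [← residue_eq_zero_iff]
    have h2 := congrFun hv t
    simp only [Matrix.vecMul, dotProduct, Matrix.map_apply, Pi.zero_apply] at h2 ⊢
    rw [map_sum, ← h2]
    exact Finset.sum_congr rfl fun s _ => by rw [map_mul, hw]
  rw [Ideal.span_le]
  rintro _ ⟨t, rfl⟩
  have : a = M⁻¹.mulVec b := by
    rw [← hMa, Matrix.mulVec_mulVec, Matrix.nonsing_inv_mul _ hdet, Matrix.one_mulVec]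
  rw [this]
  change ∑ s, M⁻¹ t s * b s ∈ J'
  exact Ideal.sum_mem _ fun s _ => Ideal.mul_mem_left _ _ (hbJ s)

include hℓ in
theorem exists_pow_succ_eq_of_reductionNumber_eq {r : ℕ} (hr : reductionNumber I = r) :
    ∃ b : Fin ℓ → R, Ideal.span (Set.range b) ≤ I ∧
      I ^ (r + 1) = Ideal.span (Set.range b) * I ^ r := by
  have hne : {n : ℕ | ∃ J : Ideal R, IsMinimalReduction J I ∧ reductionNumberWrt J I = n}.Nonempty :=
    by
    obtain ⟨b, -, hb⟩ := (isReduction_self I).exists_fin hℓ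
    exact ⟨_, _, hb.isMinimalReduction hℓ, rfl⟩
  obtain ⟨J, hJ, hJr⟩ := Nat.sInf_mem hne
  rw [← reductionNumber, hr] at hJr
  obtain ⟨b, hbJ, hb⟩ := hJ.prop.exists_fin hℓ
  have hJb : J = Ideal.span (Set.range b) :=
    le_antisymm (hJ.2 hb (Ideal.span_le.2 (Set.range_subset_iff.2 hbJ)))
      (Ideal.span_le.2 (Set.range_subset_iff.2 hbJ))
  have hJ2 : I ^ (reductionNumberWrt J I + 1) = J * I ^ reductionNumberWrt J I :=
    Nat.sInf_mem (s := {n : ℕ | I ^ (n + 1) = J * I ^ n}) hJ.prop.2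
  rw [hJr, hJb] at hJ2
  exact ⟨b, hb.1, hJ2⟩

end FiberDimension

/-! ### Ideal arithmetic: regularity in each degree versus freeness and intersections. -/

section InitialIdeal

universe u

variable {R : Type u} [CommRing R] {ℓ : ℕ} {a : Fin ℓ → R} {I K : Ideal R}

theorem mem_initialIdeal_iff {i : ℕ} {y : R} :
    y ∈ initialIdeal a i ↔
      ∃ c : Fin ℓ → R, (∀ s : Fin ℓ, i ≤ s → c s = 0) ∧ ∑ s, c s * a s = y := by
  constructor
  · intro hy
    induction hy using Submodule.span_induction with
    | mem x hx =>
      obtain ⟨s, hs, rfl⟩ := hx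
      refine ⟨Pi.single s 1, fun t ht => Pi.single_eq_of_ne ?_ _, ?_⟩
      · rintro rfl
        exact absurd hs (not_lt.2 ht)
      · rw [Finset.sum_eq_single s] <;> simp +contextual
    | zero => exact ⟨0, by simp⟩
    | add x y _ _ hx hy =>
      obtain ⟨c, hc, rfl⟩ := hx
      obtain ⟨c', hc', rfl⟩ := hy
      exact ⟨c + c', fun s hs => by simp [hc s hs, hc' s hs], by
        simp [add_mul, Finset.sum_add_distrib]⟩
    | smul r x _ hx =>
      obtain ⟨c, hc, rfl⟩ := hx
      exact ⟨r • c, fun s hs => by simp [hc s hs], by simp [Finset.mul_sum, mul_assoc]⟩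
  · rintro ⟨c, hc, rfl⟩
    refine Ideal.sum_mem _ fun s _ => ?_
    by_cases hs : i ≤ s
    · rw [hc s hs, zero_mul]
      exact Ideal.zero_mem _
    · exact Ideal.mul_mem_left _ _ (Ideal.subset_span ⟨s, not_le.1 hs, rfl⟩)

theorem initialIdeal_zero : initialIdeal a 0 = ⊥ := by simp [initialIdeal]

theorem initialIdeal_length : initialIdeal a ℓ = Ideal.span (Set.range a) := by
  simp [initialIdeal]

theorem initialIdeal_mono {i j : ℕ} (h : i ≤ j) : initialIdeal a i ≤ initialIdeal a j :=
  Ideal.span_mono (Set.image_mono fun _ hs => lt_of_lt_of_le hs h)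

theorem initialIdeal_le (ha : ∀ s, a s ∈ I) (i : ℕ) : initialIdeal a i ≤ I :=
  Ideal.span_le.2 (by rintro _ ⟨s, -, rfl⟩; exact ha s)

theorem initialIdeal_succ {i : ℕ} (hi : i < ℓ) :
    initialIdeal a (i + 1) = initialIdeal a i ⊔ Ideal.span {a ⟨i, hi⟩} := by
  rw [initialIdeal, initialIdeal, ← Ideal.span_union]
  congr 1
  rw [Set.union_singleton, ← Set.image_insert_eq]
  congr 1
  ext s
  simp only [Set.mem_ofPred_eq, Set.mem_insert_iff, Fin.ext_iff]
  omega

theorem mem_initialIdeal_mul_of_le {i j : ℕ} (h : i ≤ j) {B : Ideal R} {y : R}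
    (hy : y ∈ initialIdeal a i * B) : y ∈ initialIdeal a j * B := by
  have h1 : initialIdeal a i * B ≤ initialIdeal a j * B := Ideal.mul_mono_left (initialIdeal_mono h)
  exact h1 hy

theorem exists_of_mem_initialIdeal_succ_mul {i : ℕ} (hi : i < ℓ) {B : Ideal R} {y : R}
    (hy : y ∈ initialIdeal a (i + 1) * B) :
    ∃ z ∈ initialIdeal a i * B, ∃ w ∈ B, z + a ⟨i, hi⟩ * w = y := by
  rw [initialIdeal_succ hi, Ideal.sup_mul, Submodule.mem_sup] at hy
  obtain ⟨z, hz, t, ht, rfl⟩ := hy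
  obtain ⟨w, hw, rfl⟩ := Ideal.mem_span_singleton_mul.1 ht
  exact ⟨z, hz, w, hw, rfl⟩

theorem le_of_descending {P : ℕ → Prop} (h0 : P ℓ) (h : ∀ i < ℓ, P (i + 1) → P i) :
    ∀ i ≤ ℓ, P i := fun _ hi =>
  Nat.decreasingInduction (motive := fun m _ => P m) (fun k hk hP => h k hk hP) h0 hi

/-- The case `j = 1` of the colon condition, available even for `r = 0` because the range reaches
`max 1 r`. -/
theorem mem_initialIdeal_of_mul_mem {r : ℕ}
    (hcolon : ∀ i : Fin ℓ, ∀ j : ℕ, 1 ≤ j → j ≤ max 1 r →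
      (initialIdeal a i * I ^ (j - 1)).colon {a i} ⊓ I ^ j = initialIdeal a i * I ^ (j - 1))
    (i : Fin ℓ) : ∀ x ∈ I, a i * x ∈ initialIdeal a i → x ∈ initialIdeal a i := by
  intro x hx hax
  have h := (hcolon i 1 le_rfl (le_max_left _ _)).le
  simp only [Nat.sub_self, pow_zero, Ideal.one_eq_top, Ideal.mul_top, pow_one] at h
  exact h ⟨Submodule.mem_colon_singleton.2 (by rwa [smul_eq_mul, mul_comm]), hx⟩

theorem initialIdeal_inf_pow_le {r : ℕ}
    (hcolon : ∀ i : Fin ℓ, ∀ j : ℕ, 1 ≤ j → j ≤ max 1 r →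
      (initialIdeal a i * I ^ (j - 1)).colon {a i} ⊓ I ^ j = initialIdeal a i * I ^ (j - 1))
    (ha : ∀ s, a s ∈ I) (hr : I ^ (r + 1) = initialIdeal a ℓ * I ^ r) (j : ℕ) :
    ∀ i < ℓ, initialIdeal a i ⊓ I ^ (j + 1) ≤ initialIdeal a i * I ^ j := by
  have hcol := mem_initialIdeal_of_mul_mem hcolon
  induction j with
  | zero =>
    intro i _
    simp
  | succ j ih =>
    by_cases hj : j + 2 ≤ max 1 r
    · intro i hi y hy
      have h1 := ih i hi ⟨hy.1, Ideal.pow_le_pow_right (by omega) hy.2⟩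
      refine (hcolon ⟨i, hi⟩ (j + 2) (by omega) hj).le
        ⟨Submodule.mem_colon_singleton.2 ?_, hy.2⟩
      rw [smul_eq_mul, show j + 2 - 1 = j + 1 by omega, pow_succ, ← mul_assoc]
      exact Ideal.mul_mem_mul h1 (ha _)
    -- Past the range of the colon conditions the induction on `i` descends from `ℓ`, where `I^(j+2)
    -- = J I^(j+1)`; the coefficient `w` of the dropped generator is pushed into `𝔞ᵢ ∩ I^(j+1)`.
    · have key : ∀ i ≤ ℓ, initialIdeal a i ⊓ I ^ (j + 2) ≤ initialIdeal a i * I ^ (j + 1) := by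
        refine le_of_descending ?_ ?_
        · refine inf_le_right.trans (le_of_eq ?_)
          obtain ⟨k, hk⟩ : ∃ k, j + 1 = r + k := ⟨j + 1 - r, by omega⟩
          rw [show j + 2 = r + (k + 1) by omega, hk, IsReduction.pow_add hr,
            IsReduction.pow_add hr, pow_succ', mul_assoc]
        · intro i hi h y hy
          obtain ⟨z, hz, w, hw, rfl⟩ := exists_of_mem_initialIdeal_succ_mul hi
            (h ⟨initialIdeal_mono i.le_succ hy.1, hy.2⟩)
          have haw : a ⟨i, hi⟩ * w ∈ initialIdeal a i :=
            (Submodule.add_mem_iff_right _ (Ideal.mul_le_left hz)).1 hy.1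
          have hwi := hcol ⟨i, hi⟩ w (Ideal.pow_le_self j.succ_ne_zero hw) haw
          refine Ideal.add_mem _ hz ?_
          rw [pow_succ, ← mul_assoc, mul_comm (a _)]
          exact Ideal.mul_mem_mul (ih i hi ⟨hwi, hw⟩) (ha ⟨i, hi⟩)
      exact fun i hi => key i hi.le

theorem initialIdeal_mul_inf_le_of_basis (ha : ∀ s, a s ∈ I)
    (hint : ∀ j, ∀ i < ℓ, initialIdeal a i ⊓ I ^ (j + 1) ≤ initialIdeal a i * I ^ j)
    (hcol : ∀ (i : Fin ℓ), ∀ x ∈ I, a i * x ∈ initialIdeal a i → x ∈ initialIdeal a i)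
    (hbasis : ∀ c : Fin ℓ → R, ∑ s, c s * a s ∈ K * initialIdeal a ℓ → ∀ s, c s ∈ K)
    (hVV : ∀ j, initialIdeal a ℓ * I ^ j ⊓ K * I ^ (j + 1) ≤ initialIdeal a ℓ * (K * I ^ j))
    (j : ℕ) : ∀ i ≤ ℓ,
      initialIdeal a i * I ^ j ⊓ K * I ^ (j + 1) ≤ initialIdeal a i * (K * I ^ j) := by
  induction j with
  | zero =>
    intro i hi y hy
    have hy1 : y ∈ initialIdeal a i := Ideal.mul_le_left hy.1
    have h1 := hVV 0 ⟨by simpa using initialIdeal_mono hi hy1, hy.2⟩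
    rw [pow_zero, mul_one] at h1 ⊢
    obtain ⟨c, hc, rfl⟩ := mem_initialIdeal_iff.1 hy1
    have hcK := hbasis c (by rwa [mul_comm] at h1)
    refine Ideal.sum_mem _ fun s _ => ?_
    by_cases hs : i ≤ s
    · rw [hc s hs, zero_mul]
      exact Ideal.zero_mem _
    · rw [mul_comm (c s)]
      exact Ideal.mul_mem_mul (Ideal.subset_span ⟨s, not_le.1 hs, rfl⟩) (hcK s)
  | succ j ih =>
    refine le_of_descending (hVV (j + 1)) ?_
    intro i hi h y hy
    obtain ⟨z, hz, w, hw, rfl⟩ := exists_of_mem_initialIdeal_succ_mul hi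
      (h ⟨mem_initialIdeal_mul_of_le i.le_succ hy.1, hy.2⟩)
    have hwI : w ∈ I ^ (j + 1) := Ideal.mul_le_right hw
    have haw : a ⟨i, hi⟩ * w ∈ initialIdeal a i :=
      (Submodule.add_mem_iff_right _ (Ideal.mul_le_left hz)).1 (Ideal.mul_le_left hy.1)
    have hwi := hcol ⟨i, hi⟩ w (Ideal.pow_le_self j.succ_ne_zero hwI) haw
    have h1 := ih i hi.le ⟨hint j i hi ⟨hwi, hwI⟩, hw⟩
    refine Ideal.add_mem _ hz ?_
    rw [pow_succ, ← mul_assoc, ← mul_assoc, mul_comm (a _), mul_assoc (initialIdeal a i)]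
    exact Ideal.mul_mem_mul h1 (ha ⟨i, hi⟩)

/-- The `K I^(j+1)` part of `a i * x` lies in `𝔞ᵢ₊₁ K I^j`, so subtracting some `w ∈ K I^j` from `x`
leaves `a i * (x - w) ∈ 𝔞ᵢ I^j`. Then `x - w` is handled by `hbasis` if `j = 0` and by `hcol` and
`hint` otherwise. -/
theorem regular_of_basis (ha : ∀ s, a s ∈ I)
    (hint : ∀ j, ∀ i < ℓ, initialIdeal a i ⊓ I ^ (j + 1) ≤ initialIdeal a i * I ^ j)
    (hcol : ∀ (i : Fin ℓ), ∀ x ∈ I, a i * x ∈ initialIdeal a i → x ∈ initialIdeal a i)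
    (hbasis : ∀ c : Fin ℓ → R, ∑ s, c s * a s ∈ K * initialIdeal a ℓ → ∀ s, c s ∈ K)
    (hVV : ∀ j, initialIdeal a ℓ * I ^ j ⊓ K * I ^ (j + 1) ≤ initialIdeal a ℓ * (K * I ^ j))
    (i : Fin ℓ) (j : ℕ) {x : R} (hx : x ∈ I ^ j)
    (hax : a i * x ∈ coeffIdeal I K (initialIdeal a i) (j + 1)) :
    x ∈ coeffIdeal I K (initialIdeal a i) j := by
  obtain ⟨z, hz, t, ht, hzt⟩ := Submodule.mem_sup.1 hax
  have hsucc := initialIdeal_succ (a := a) i.2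
  have hmem : t ∈ initialIdeal a (i + 1) * I ^ j := by
    rw [← Submodule.add_mem_iff_right _ (mem_initialIdeal_mul_of_le (Nat.le_succ i) hz),
      hzt, hsucc]
    exact Ideal.mul_mem_mul (Ideal.mem_sup_right (Ideal.mem_span_singleton_self _)) hx
  have htE := initialIdeal_mul_inf_le_of_basis ha hint hcol hbasis hVV j (i + 1) i.2 ⟨hmem, ht⟩
  obtain ⟨z', hz', w, hw, rfl⟩ := exists_of_mem_initialIdeal_succ_mul i.2 htE
  have hxw : a i * (x - w) ∈ initialIdeal a i * I ^ j := by
    rw [mul_sub, ← hzt]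
    have hle : initialIdeal a i * (K * I ^ j) ≤ initialIdeal a i * I ^ j :=
      Ideal.mul_mono_right Ideal.mul_le_right
    have := Ideal.add_mem _ hz (hle hz')
    convert this using 1
    ring
  cases j with
  | zero =>
    rw [pow_zero, mul_one] at hxw hw
    obtain ⟨c, hc, hcx⟩ := mem_initialIdeal_iff.1 hxw
    have h1 := hbasis (fun s => Pi.single (M := fun _ => R) i (x - w) s - c s) (by
      simp only [sub_mul, Finset.sum_sub_distrib, hcx]
      rw [Finset.sum_eq_single i (by simp +contextual) (by simp)]
      simp [mul_comm]) i
    rw [Pi.single_eq_same, hc i le_rfl, sub_zero] at h1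
    exact (Submodule.sub_mem_iff_left _ hw).1 h1
  | succ j =>
    have hxwI : x - w ∈ I ^ (j + 1) := Ideal.sub_mem _ hx (Ideal.mul_le_right hw)
    have h1 := hcol i _ (Ideal.pow_le_self j.succ_ne_zero hxwI) (Ideal.mul_le_left hxw)
    rw [← sub_add_cancel x w]
    exact Submodule.add_mem_sup (hint j i i.2 ⟨h1, hxwI⟩) hw

/-- Coefficients are treated from the last index down: once the later ones are in `K`, the current
term lies in `𝔞ₛ + KI`, and regularity in degree 0 applies. -/
theorem coeff_mem_of_regular
    (hreg : ∀ (i : Fin ℓ) (j : ℕ), ∀ x ∈ I ^ j,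
      a i * x ∈ coeffIdeal I K (initialIdeal a i) (j + 1) → x ∈ coeffIdeal I K (initialIdeal a i) j)
    (c : Fin ℓ → R) (hc : ∑ s, c s * a s ∈ K * I) (ha : ∀ s, a s ∈ I) :
    ∀ s, c s ∈ K := by
  have key : ∀ k ≤ ℓ, ∀ s : Fin ℓ, k ≤ s → c s ∈ K := by
    refine le_of_descending (fun s hs => absurd s.2 (not_lt.2 hs)) fun k hk h s hs => ?_
    rcases hs.eq_or_lt with rfl | hs
    · refine hreg s 0 (c s) (by simp) ?_
      have hspl : a s * c s = -(∑ t, (if t < s then c t else 0) * a t) +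
          (∑ t, c t * a t - ∑ t, (if s < t then c t else 0) * a t) := by
        rw [mul_comm, eq_comm, neg_add_eq_sub, sub_sub, ← Finset.sum_add_distrib,
          ← Finset.sum_sub_distrib, Finset.sum_eq_single s]
        · simp
        · intro t _ hts
          rcases hts.lt_or_gt with h1 | h1 <;> simp [h1, h1.not_gt]
        · simp
      rw [hspl]
      refine Submodule.add_mem_sup (Ideal.neg_mem_iff _ |>.2 ?_) (Ideal.sub_mem _ (by simpa) ?_)
      · rw [pow_zero, mul_one]
        exact mem_initialIdeal_iff.2 ⟨_, fun t ht => if_neg (not_lt.2 ht), rfl⟩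
      · refine Ideal.sum_mem _ fun t _ => ?_
        split_ifs with hst
        · rw [zero_add, pow_one]
          exact Ideal.mul_mem_mul (h t hst) (ha t)
        · rw [zero_mul]
          exact Ideal.zero_mem _
    · exact h s hs
  exact fun s => key 0 (Nat.zero_le _) s (Nat.zero_le _)

theorem initialIdeal_mul_inf_le_of_regular (ha : ∀ s, a s ∈ I)
    (hreg : ∀ (i : Fin ℓ) (j : ℕ), ∀ x ∈ I ^ j,
      a i * x ∈ coeffIdeal I K (initialIdeal a i) (j + 1) → x ∈ coeffIdeal I K (initialIdeal a i) j)
    (j : ℕ) : ∀ i ≤ ℓ,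
      initialIdeal a i * I ^ j ⊓ K * I ^ (j + 1) ≤ initialIdeal a i * (K * I ^ j) := by
  cases j with
  | zero =>
    intro i _ y hy
    rw [pow_zero, mul_one, zero_add, pow_one] at hy
    rw [pow_zero, mul_one]
    obtain ⟨c, hc, rfl⟩ := mem_initialIdeal_iff.1 hy.1
    have hcK := coeff_mem_of_regular hreg c hy.2 ha
    refine Ideal.sum_mem _ fun s _ => ?_
    by_cases hs : i ≤ s
    · rw [hc s hs, zero_mul]
      exact Ideal.zero_mem _
    · rw [mul_comm (c s)]
      exact Ideal.mul_mem_mul (Ideal.subset_span ⟨s, not_le.1 hs, rfl⟩) (hcK s)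
  | succ j =>
    intro i
    induction i with
    | zero => intro _; rw [initialIdeal_zero, Ideal.bot_mul]; simp
    | succ i ih =>
      intro hi y hy
      obtain ⟨z, hz, w, hw, rfl⟩ := exists_of_mem_initialIdeal_succ_mul hi hy.1
      have h1 := hreg ⟨i, hi⟩ (j + 1) w hw <| by
        have h2 : a ⟨i, hi⟩ * w = -z + (z + a ⟨i, hi⟩ * w) := by ring
        rw [h2]
        exact Submodule.add_mem_sup (Ideal.neg_mem_iff _ |>.2 hz) hy.2
      obtain ⟨w1, hw1, w2, hw2, rfl⟩ := Submodule.mem_sup.1 h1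
      have h3 : a ⟨i, hi⟩ * w1 ∈ initialIdeal a i * I ^ (j + 1) := by
        rw [pow_succ, ← mul_assoc, mul_comm (a _)]
        exact Ideal.mul_mem_mul hw1 (ha _)
      have h4 : a ⟨i, hi⟩ * w2 ∈ K * I ^ (j + 1 + 1) := by
        rw [pow_succ, ← mul_assoc, mul_comm (a _)]
        exact Ideal.mul_mem_mul hw2 (ha _)
      have h5 := ih (by omega) (x := z + a ⟨i, hi⟩ * w1) ⟨Ideal.add_mem _ hz h3, by
        rw [mul_add, ← add_assoc] at hy
        exact (Submodule.add_mem_iff_left _ h4).1 hy.2⟩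
      rw [mul_add, ← add_assoc]
      refine Ideal.add_mem _ (mem_initialIdeal_mul_of_le i.le_succ h5) ?_
      exact Ideal.mul_mem_mul (Ideal.subset_span ⟨⟨i, hi⟩, i.lt_succ_self, rfl⟩) hw2

end InitialIdeal

/-! ### General elements attain the reduction number. -/

section GeneralElements

open IsLocalRing

universe u

variable {R : Type u} [CommRing R]

theorem exists_finset_minimal_span_eq {ι : Type*} [Finite ι] (w : ι → R) :
    ∃ T : Finset ι, Ideal.span (w '' T) = Ideal.span (Set.range w) ∧
      ∀ t ∈ T, ∀ S : Finset ι, S ⊂ T → Ideal.span (w '' S) ≠ Ideal.span (Set.range w) := by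
  classical
  have := Fintype.ofFinite ι
  obtain ⟨T, hT⟩ := (Set.toFinite {T : Finset ι | Ideal.span (w '' T) =
    Ideal.span (Set.range w)}).exists_minimal ⟨Finset.univ, by simp⟩
  exact ⟨T, hT.prop, fun t _ S hS h => hS.2 (hT.2 h hS.1)⟩

variable [IsLocalRing R] {I : Ideal R}

theorem coeff_mem_maximalIdeal_of_minimal_span {ι : Type*} [DecidableEq ι] {w : ι → R}
    {T : Finset ι}
    (hT : ∀ S : Finset ι, S ⊂ T → Ideal.span (w '' S) ≠ Ideal.span (w '' T))
    (c : T → R) (hc : ∑ t, c t * w t = 0) (t : T) : c t ∈ maximalIdeal R := by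
  by_contra ht
  rw [mem_maximalIdeal, mem_nonunits_iff, not_not] at ht
  refine hT (T.erase t) (Finset.erase_ssubset t.2) (le_antisymm
    (Ideal.span_mono (Set.image_mono (Finset.coe_subset.2 (Finset.erase_subset _ _)))) ?_)
  rw [Ideal.span_le]
  rintro _ ⟨s, hs, rfl⟩
  by_cases hst : s = t
  · rw [SetLike.mem_coe, hst, ← Ideal.unit_mul_mem_iff_mem _ ht]
    rw [← Finset.add_sum_erase _ _ (Finset.mem_univ t)] at hc
    rw [eq_neg_of_add_eq_zero_left hc, Ideal.neg_mem_iff]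
    refine Ideal.sum_mem _ fun s hs => Ideal.mul_mem_left _ _ (Ideal.subset_span ⟨s, ?_, rfl⟩)
    have := (Finset.mem_erase.1 hs).1
    simp only [Finset.coe_erase]
    exact ⟨s.2, fun h => this (Subtype.ext h)⟩
  · exact Ideal.subset_span ⟨s, by simpa using ⟨hs, hst⟩, rfl⟩

theorem mapMatrix_residue_eq_one_of_minimal_span {ι : Type*} [DecidableEq ι] {w : ι → R}
    {T : Finset ι}
    (hT : ∀ S : Finset ι, S ⊂ T → Ideal.span (w '' S) ≠ Ideal.span (w '' T))
    (A : Matrix T T R) (hA : ∀ t : T, ∑ t', A t t' * w t' = w t) :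
    (residue R).mapMatrix A = 1 := by
  ext t t'
  have h := coeff_mem_maximalIdeal_of_minimal_span hT
    (fun t' => A t t' - (1 : Matrix T T R) t t') (by
      simp only [sub_mul, Finset.sum_sub_distrib]
      exact sub_eq_zero.2 ((hA t).trans (by simp [Matrix.one_apply]))) t'
  rw [← residue_eq_zero_iff, map_sub, sub_eq_zero] at h
  rw [RingHom.mapMatrix_apply, Matrix.map_apply, h, Matrix.one_apply, Matrix.one_apply]
  split_ifs <;> simp

/-- Choose a minimal generating set of `I^(r+1)` among the products `b i * m q`. The corresponding
products for general elements are `M x` times these generators, so `I^(r+1) = A I^r`, with `A` the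
ideal of the general elements, as soon as `det (M x)` is a unit; `g` is this determinant modulo `𝔪`.
It is nonzero because at the coefficients of `b` the matrix reduces to the identity. -/
theorem exists_mvPolynomial_pow_succ_eq [IsNoetherianRing R] {ℓ n r : ℕ} {f : Fin n → R}
    (hf : Ideal.span (Set.range f) = I) {b : Fin ℓ → R} (hb : Ideal.span (Set.range b) ≤ I)
    (hr : I ^ (r + 1) = Ideal.span (Set.range b) * I ^ r) :
    ∃ g : MvPolynomial (Fin ℓ × Fin n) (ResidueField R), g ≠ 0 ∧
      ∀ x : Fin ℓ × Fin n → R, MvPolynomial.eval (fun p => residue R (x p)) g ≠ 0 →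
        I ^ (r + 1) = Ideal.span (Set.range fun i => ∑ s, x (i, s) * f s) * I ^ r := by
  classical
  have hy : ∀ i, ∃ y : Fin n → R, ∑ s, y s * f s = b i := fun i =>
    Ideal.mem_span_range_iff_exists_fun.1 (hf ▸ hb (Ideal.subset_span ⟨i, rfl⟩))
  choose y hy using hy
  obtain ⟨N, m, hm⟩ := Submodule.fg_iff_exists_fin_generating_family.1
    (IsNoetherian.noetherian (I ^ r))
  let w : Fin ℓ × Fin N → R := fun p => b p.1 * m p.2
  have hw : Ideal.span (Set.range w) = I ^ (r + 1) := by
    rw [hr, ← hm, Ideal.submodule_span_eq, Ideal.span_mul_span']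
    congr 1
    ext z
    simp [w, Set.mem_mul]
  obtain ⟨T, hT, hTmin⟩ := exists_finset_minimal_span_eq w
  have hTmin' : ∀ S : Finset (Fin ℓ × Fin N), S ⊂ T →
      Ideal.span (w '' S) ≠ Ideal.span (w '' T) := by
    intro S hS
    obtain ⟨t, ht, -⟩ := Finset.exists_of_ssubset hS
    rw [hT]
    exact hTmin t ht S hS
  have hfm : ∀ (s : Fin n) (q : Fin N), ∃ c : T → R, ∑ t, c t * w t = f s * m q := by
    intro s q
    have : f s * m q ∈ Ideal.span (w '' T) := by
      rw [hT, hw, pow_succ']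
      exact Ideal.mul_mem_mul (hf ▸ Ideal.subset_span ⟨s, rfl⟩)
        (hm ▸ Submodule.subset_span ⟨q, rfl⟩)
    rw [Set.image_eq_range] at this
    exact Ideal.mem_span_range_iff_exists_fun.1 this
  choose c hc using hfm
  let M : (Fin ℓ × Fin n → R) → Matrix T T R := fun x =>
    Matrix.of fun t t' => ∑ s, x (t.1.1, s) * c s t.1.2 t'
  have hM : ∀ x (t : T), (∑ s, x (t.1.1, s) * f s) * m t.1.2 = ∑ t', M x t t' * w t' := by
    intro x t
    simp only [M, Matrix.of_apply, Finset.sum_mul]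
    rw [Finset.sum_comm]
    refine Finset.sum_congr rfl fun s _ => ?_
    rw [mul_assoc, ← hc, Finset.mul_sum]
    exact Finset.sum_congr rfl fun t' _ => by ring
  let G : Matrix T T (MvPolynomial (Fin ℓ × Fin n) (ResidueField R)) :=
    Matrix.of fun t t' => ∑ s, MvPolynomial.X (t.1.1, s) * MvPolynomial.C (residue R (c s t.1.2 t'))
  have hG : ∀ x : Fin ℓ × Fin n → R,
      MvPolynomial.eval (fun p => residue R (x p)) G.det = residue R (M x).det := by
    intro x
    rw [RingHom.map_det, RingHom.map_det]
    congr 1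
    ext t t'
    simp [G, M]
  have hwt : ∀ t, w t = b t.1 * m t.2 := fun _ => rfl
  clear_value M w G
  refine ⟨G.det, fun h0 => ?_, fun x hx => ?_⟩
  · have h1 := hG fun p => y p.1 p.2
    have hMy : ∀ t : T, ∑ t', M (fun p => y p.1 p.2) t t' * w t' = w t := fun t => by
      refine (hM (fun p => y p.1 p.2) t).symm.trans ?_
      rw [hwt, ← hy t.1.1]
    have h2 := mapMatrix_residue_eq_one_of_minimal_span hTmin' (M fun p => y p.1 p.2) hMy
    rw [h0, map_zero, RingHom.map_det, h2, Matrix.det_one] at h1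
    exact zero_ne_one h1
  · rw [hG, Ne, residue_eq_zero_iff, mem_maximalIdeal, mem_nonunits_iff, not_not] at hx
    set A := Ideal.span (Set.range fun i => ∑ s, x (i, s) * f s) with hA
    have hAI : A ≤ I := by
      rw [hA, Ideal.span_le]
      rintro _ ⟨i, rfl⟩
      exact Ideal.sum_mem _ fun s _ => Ideal.mul_mem_left _ _ (hf ▸ Ideal.subset_span ⟨s, rfl⟩)
    refine le_antisymm ?_ (by rw [pow_succ']; exact Ideal.mul_mono_left hAI)
    rw [← hw, ← hT, Ideal.span_le]
    rintro _ ⟨t, ht, rfl⟩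
    let v : T → R := fun t => (∑ s, x (t.1.1, s) * f s) * m t.1.2
    have hv : (M x).mulVec (fun t => w t) = v := funext fun t => (hM x t).symm
    have : (fun t : T => w t) = (M x)⁻¹.mulVec v := by
      rw [← hv, Matrix.mulVec_mulVec, Matrix.nonsing_inv_mul _ hx, Matrix.one_mulVec]
    have h4 := congrFun this ⟨t, ht⟩
    change w t = ∑ s, (M x)⁻¹ ⟨t, ht⟩ s * v s at h4
    rw [SetLike.mem_coe, h4]
    exact Ideal.sum_mem _ fun s _ => Ideal.mul_mem_left _ _ <|
      Ideal.mul_mem_mul (Ideal.subset_span ⟨_, rfl⟩) (hm ▸ Submodule.subset_span ⟨_, rfl⟩)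

end GeneralElements

/-! ### Freeness of `J / KJ` in terms of coefficients. -/

section FreeQuotient

open IsLocalRing

universe u

variable {R : Type u} [CommRing R] {ℓ : ℕ} {a : Fin ℓ → R} {J K : Ideal R}

/-- The class of `aₛ` in `J / KJ`. -/
def quotientGenerator (K : Ideal R) (ha : ∀ s, a s ∈ J) (s : Fin ℓ) :
    J ⧸ (K • ⊤ : Submodule R J) :=
  Submodule.Quotient.mk ⟨a s, ha s⟩

theorem sum_smul_quotientGenerator_eq_zero_iff (ha : ∀ s, a s ∈ J) (c : Fin ℓ → R) :
    ∑ s, (Ideal.Quotient.mk K (c s)) • quotientGenerator K ha s = 0 ↔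
      ∑ s, c s * a s ∈ K * J := by
  have : ∑ s, (Ideal.Quotient.mk K (c s)) • quotientGenerator K ha s =
      Submodule.mkQ (K • ⊤ : Submodule R J) (∑ s, c s • ⟨a s, ha s⟩) := by
    rw [map_sum]; rfl
  rw [this, Submodule.mkQ_apply, Submodule.Quotient.mk_eq_zero, Submodule.mem_smul_top_iff]
  simp

theorem span_quotientGenerator (ha : ∀ s, a s ∈ J) (hJ : J = Ideal.span (Set.range a)) :
    ⊤ ≤ Submodule.span (R ⧸ K) (Set.range (quotientGenerator K ha)) := by
  rintro x -
  obtain ⟨⟨x, hx⟩, rfl⟩ := Submodule.Quotient.mk_surjective _ x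
  obtain ⟨c, hc⟩ := Ideal.mem_span_range_iff_exists_fun.1 (hJ ▸ hx)
  have : (Submodule.Quotient.mk ⟨x, hx⟩ : J ⧸ (K • ⊤ : Submodule R J)) =
      ∑ s, (Ideal.Quotient.mk K (c s)) • quotientGenerator K ha s := by
    have h1 : (⟨x, hx⟩ : J) = ∑ s, c s • ⟨a s, ha s⟩ := Subtype.ext (by simp [hc])
    rw [h1, ← Submodule.mkQ_apply, map_sum]; rfl
  rw [this]
  exact Submodule.sum_mem _ fun s _ => Submodule.smul_mem _ _ (Submodule.subset_span ⟨s, rfl⟩)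

theorem free_quotient_of_coeff_mem (hJ : J = Ideal.span (Set.range a))
    (h : ∀ c : Fin ℓ → R, ∑ s, c s * a s ∈ K * J → ∀ s, c s ∈ K) :
    Module.Free (R ⧸ K) (J ⧸ (K • ⊤ : Submodule R J)) := by
  have ha : ∀ s, a s ∈ J := fun s => hJ ▸ Ideal.subset_span ⟨s, rfl⟩
  refine Module.Free.of_basis (Module.Basis.mk (v := quotientGenerator K ha) ?_
    (span_quotientGenerator ha hJ))
  rw [Fintype.linearIndependent_iff]
  intro g hg
  choose c hc using fun s => Ideal.Quotient.mk_surjective (g s)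
  obtain rfl : (fun s => Ideal.Quotient.mk K (c s)) = g := funext hc
  exact fun s => Ideal.Quotient.eq_zero_iff_mem.2
    (h c ((sum_smul_quotientGenerator_eq_zero_iff ha c).1 hg) s)

/-- The surjection `(R/K)^ℓ → J/KJ` splits, so its kernel is a direct summand. By `hmin` the kernel
has coordinates in the maximal ideal; projecting back onto it shows `ker ⊆ 𝔪 ker`, hence it
vanishes. -/
theorem coeff_mem_of_free_quotient [IsLocalRing R] [IsNoetherianRing R] (hK : K ≤ maximalIdeal R)
    (hJ : J = Ideal.span (Set.range a))
    (hmin : ∀ c : Fin ℓ → R, ∑ s, c s * a s ∈ K * J → ∀ s, c s ∈ maximalIdeal R)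
    (hfree : Module.Free (R ⧸ K) (J ⧸ (K • ⊤ : Submodule R J))) (c : Fin ℓ → R)
    (hc : ∑ s, c s * a s ∈ K * J) (s : Fin ℓ) : c s ∈ K := by
  have ha : ∀ s, a s ∈ J := fun s => hJ ▸ Ideal.subset_span ⟨s, rfl⟩
  have : Nontrivial (R ⧸ K) :=
    Ideal.Quotient.nontrivial_iff.2 fun h =>
      (Ideal.IsPrime.ne_top inferInstance) (top_le_iff.1 (h ▸ hK))
  have : IsLocalRing (R ⧸ K) :=
    IsLocalRing.of_surjective' (Ideal.Quotient.mk K) Ideal.Quotient.mk_surjective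
  let φ := Fintype.linearCombination (R ⧸ K) (quotientGenerator K ha)
  have hφ : Function.Surjective φ := by
    rw [← LinearMap.range_eq_top, Fintype.range_linearCombination]
    exact top_le_iff.1 (span_quotientGenerator ha hJ)
  obtain ⟨σ, hσ⟩ := Module.projective_lifting_property φ LinearMap.id hφ
  let P : (Fin ℓ → R ⧸ K) →ₗ[R ⧸ K] (Fin ℓ → R ⧸ K) := LinearMap.id - σ ∘ₗ φ
  have hP : ∀ x, P x ∈ LinearMap.ker φ := fun x => by
    have := LinearMap.congr_fun hσ (φ x)
    simp only [LinearMap.comp_apply, LinearMap.id_apply] at this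
    simp [P, this]
  have hker : LinearMap.ker φ = ⊥ := by
    refine Submodule.eq_bot_of_le_smul_of_le_jacobson_bot (maximalIdeal (R ⧸ K)) _
      (IsNoetherian.noetherian _) ?_ ?_
    · intro x hx
      choose d hd using fun s => Ideal.Quotient.mk_surjective (x s)
      have hxP : x = P x := by
        have : φ x = 0 := hx
        simp [P, this]
      have hdm := hmin d ((sum_smul_quotientGenerator_eq_zero_iff ha d).1 (by
        simpa [φ, Fintype.linearCombination_apply, hd] using hx))
      have hsum := LinearMap.pi_apply_eq_sum_univ P x
      rw [hxP, hsum]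
      refine Submodule.sum_mem _ fun s _ => Submodule.smul_mem_smul ?_ (hP _)
      rw [← hd s, mem_maximalIdeal, mem_nonunits_iff]
      intro hu
      have := Function.Surjective.isLocalHom (Ideal.Quotient.mk K) Ideal.Quotient.mk_surjective
      exact hdm s (isUnit_of_map_unit _ _ hu)
    · rw [IsLocalRing.jacobson_eq_maximalIdeal _ bot_ne_top]
  have hmem : (fun s => Ideal.Quotient.mk K (c s)) ∈ LinearMap.ker φ := by
    rw [LinearMap.mem_ker]
    exact (sum_smul_quotientGenerator_eq_zero_iff ha c).2 hc
  rw [hker, Submodule.mem_bot] at hmem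
  exact Ideal.Quotient.eq_zero_iff_mem.1 (congrFun hmem s)

end FreeQuotient

/-! ### Cohen–Macaulayness of the fiber ring versus regularity of the `aᵢ t`. -/

section CohenMacaulayFiber

open IsLocalRing RingTheory.Sequence Polynomial

universe u

variable {R : Type u} [CommRing R] {I K : Ideal R} {ℓ : ℕ} {a : Fin ℓ → R}

/-- The sequence of the classes of the `aᵢ t` in `𝓡 / K𝓡`. -/
noncomputable def fiberSequence (K : Ideal R) (ha : ∀ s, a s ∈ I) : List (ReesFiber I K) :=
  List.ofFn fun i => fiberDegreeOne K ⟨a i, ha i⟩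

theorem ofList_take_fiberSequence (ha : ∀ s, a s ∈ I) {i : ℕ} (hi : i ≤ ℓ) :
    Ideal.ofList ((fiberSequence K ha).take i) = fiberIdeal I K (initialIdeal a i) := by
  induction i with
  | zero => simp [initialIdeal_zero, fiberIdeal_bot]
  | succ i ih =>
    have h : i < (fiberSequence K ha).length := by simpa [fiberSequence] using hi
    rw [List.take_succ_eq_append_getElem h, Ideal.ofList_append, ih (by omega),
      initialIdeal_succ (Nat.lt_of_succ_le hi), Ideal.ofList_singleton,
      fiberIdeal_sup _ ⟨a ⟨i, hi⟩, ha _⟩]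
    simp [fiberSequence]

theorem holdsAlong_fiberSequence (ha : ∀ s, a s ∈ I)
    (P : Ideal (ReesFiber I K) → ReesFiber I K → Prop) :
    HoldsAlong P ⊥ (fiberSequence K ha) ↔
      ∀ i : Fin ℓ, P (fiberIdeal I K (initialIdeal a i)) (fiberDegreeOne K ⟨a i, ha i⟩) := by
  have hlen : (fiberSequence K ha).length = ℓ := by simp [fiberSequence]
  have hget : ∀ i (h : i < (fiberSequence K ha).length), (fiberSequence K ha)[i] =
      fiberDegreeOne K ⟨a ⟨i, hlen ▸ h⟩, ha _⟩ := fun i h => by simp [fiberSequence]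
  rw [holdsAlong_iff]
  constructor
  · intro h i
    have := h i (hlen.symm ▸ i.2)
    rwa [bot_sup_eq, ofList_take_fiberSequence ha i.2.le, hget] at this
  · intro h i hi
    rw [bot_sup_eq, ofList_take_fiberSequence ha (hlen ▸ hi.le), hget]
    exact h ⟨i, hlen ▸ hi⟩

variable [IsLocalRing R]

theorem fiberMaximal_le_radical_fiberIdeal (hK : K.radical = maximalIdeal R) {J : Ideal R}
    (hJ : IsReduction J I) :
    fiberMaximal I (le_maximalIdeal_of_radical_eq hK) ≤ (fiberIdeal I K J).radical := by
  obtain ⟨hJI, n, hn⟩ := hJ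
  intro u hu
  obtain ⟨p, rfl⟩ := ReesFiber.mk_surjective K u
  rw [mk_mem_fiberMaximal_iff] at hu
  rw [← sum_reesMonomial_coeff p, map_sum]
  refine Ideal.sum_mem _ fun j _ => ?_
  have key : ∃ N, p.1.coeff j ^ N ∈ coeffIdeal I K J (j * N) := by
    cases j with
    | zero =>
      obtain ⟨N, hN⟩ := (hK.symm ▸ hu : p.1.coeff 0 ∈ K.radical)
      exact ⟨N, by simpa [coeffIdeal] using hN⟩
    | succ j =>
      -- The power lies in `I^((j+1)(n+1))`, whose exponent is at least `n + 1`, so one factor `J`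
      -- splits off.
      refine ⟨n + 1, ?_⟩
      have h1 := Ideal.pow_mem_pow (p.2 (j + 1)) (n + 1)
      rw [← pow_mul] at h1
      obtain ⟨k, hk⟩ : ∃ k, (j + 1) * (n + 1) = n + 1 + k := ⟨j * (n + 1), by ring⟩
      rw [hk] at h1 ⊢
      rw [show n + 1 + k = n + k + 1 by ring] at h1 ⊢
      refine Ideal.mem_sup_left ?_
      rwa [show n + k + 1 = n + 1 + k by ring, _root_.pow_add, hn, mul_assoc,
        ← _root_.pow_add] at h1
  obtain ⟨N, hN⟩ := key
  refine ⟨N, ?_⟩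
  rw [← map_pow, mk_mem_fiberIdeal_iff hJI]
  intro k
  rw [SubmonoidClass.coe_pow, coe_reesMonomial, monomial_pow, coeff_monomial]
  split_ifs with h
  · exact h ▸ hN
  · exact Ideal.zero_mem _

variable [IsNoetherianRing R]

/-- The field `G/n` is a finitely generated algebra over the residue field of `R`, since `K`
contains a power of each element of `𝔪`. By the Nullstellensatz it is finite, hence integral over
`R`. -/
theorem exists_monic_aeval_mem_of_isMaximal (hK : K.radical = maximalIdeal R)
    (n : Ideal (ReesFiber I K)) [n.IsMaximal] (u : ReesFiber I K) :
    ∃ g : R[X], g.Monic ∧ aeval u g ∈ n := by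
  let _ : Field (ReesFiber I K ⧸ n) := Ideal.Quotient.field n
  have hft : Algebra.FiniteType R (ReesFiber I K) :=
    Algebra.FiniteType.of_surjective (ReesFiber.mk I K) (ReesFiber.mk_surjective K)
  let f : R →+* ReesFiber I K ⧸ n := (Ideal.Quotient.mk n).comp (algebraMap R (ReesFiber I K))
  have hf : f.FiniteType := RingHom.FiniteType.comp
    (RingHom.FiniteType.of_surjective _ Ideal.Quotient.mk_surjective)
    (RingHom.finiteType_algebraMap.2 hft)
  have hker : ∀ x ∈ maximalIdeal R, f x = 0 := by
    intro x hx
    rw [← hK] at hx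
    obtain ⟨m, hm⟩ := hx
    have h0 : algebraMap R (ReesFiber I K) (x ^ m) = 0 := by
      rw [← AlgHom.commutes (ReesFiber.mk I K)]
      exact Ideal.Quotient.eq_zero_iff_mem.2 (Ideal.mem_map_of_mem _ hm)
    refine eq_zero_of_pow_eq_zero (n := m) ?_
    rw [← map_pow, RingHom.comp_apply, h0, map_zero]
  let fbar : ResidueField R →+* ReesFiber I K ⧸ n := Ideal.Quotient.lift (maximalIdeal R) f hker
  have hcomp : fbar.comp (residue R) = f := RingHom.ext fun _ => rfl
  have hfin : fbar.Finite := RingHom.finite_iff_finiteType_of_isJacobsonRing.2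
    (RingHom.FiniteType.of_comp_finiteType (f := residue R) (hcomp.symm ▸ hf))
  obtain ⟨g, hg, hgu⟩ := hcomp ▸ RingHom.IsIntegral.trans _ _
    (RingHom.isIntegral_of_surjective _ residue_surjective) hfin.to_isIntegral
    (Ideal.Quotient.mk n u)
  refine ⟨g, hg, Ideal.Quotient.eq_zero_iff_mem.1 ?_⟩
  rw [← hgu, aeval_def, hom_eval₂]

/-- The `aᵢt` need not lie in `n`, so they are replaced by monic polynomials in them. The resulting
regular sequence in `G_n` has length `ℓ`, while `dim G_n ≤ dim G = ℓ`. -/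
theorem isCohenMacaulay_reesFiber_of_regular [Infinite (ResidueField R)]
    (hℓ : analyticSpread I = ℓ) (hK : K.radical = maximalIdeal R) (ha : ∀ s, a s ∈ I)
    (hreg : ∀ (i : Fin ℓ) (j : ℕ), ∀ x ∈ I ^ j,
      a i * x ∈ coeffIdeal I K (initialIdeal a i) (j + 1) → x ∈ coeffIdeal I K (initialIdeal a i) j) :
    IsCohenMacaulay (ReesFiber I K) := by
  refine ⟨inferInstance, fun n _ => ⟨inferInstance, ?_⟩⟩
  choose g hg hgn using fun i => exists_monic_aeval_mem_of_isMaximal hK n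
    (fiberDegreeOne K ⟨a i, ha i⟩)
  let zs : List (ReesFiber I K) := List.ofFn fun i => aeval (fiberDegreeOne K ⟨a i, ha i⟩) (g i)
  have hzs : ∀ z ∈ zs, z ∈ n := by
    intro z hz
    obtain ⟨i, rfl⟩ := List.mem_ofFn.1 hz
    exact hgn i
  have hweak : IsWeaklyRegular (ReesFiber I K) zs := by
    refine (isWeaklyRegular_iff_holdsAlong zs).2 (HoldsAlong.of_hasLeadingForm
      (Fil := fiberFiltration I K) fiberFiltration_mono exists_mem_fiberFiltration
      fiberFiltration_zero (xs := fiberSequence K ha) ?_ ?_ ?_)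
    · intro x hx
      obtain ⟨i, rfl⟩ := List.mem_ofFn.1 hx
      exact fiberDegreeOne_mul_mem_fiberFiltration _
    · refine List.forall₂_iff_get.2 ⟨by simp [fiberSequence, zs], fun i h₁ h₂ => ?_⟩
      simp only [fiberSequence, zs, List.get_eq_getElem, List.getElem_ofFn]
      exact ⟨_, hasLeadingForm_aeval fiberFiltration_mono
        (fiberDegreeOne_mul_mem_fiberFiltration _) (hg _)⟩
    · exact (holdsAlong_fiberSequence ha _).2 fun i =>
        strictMod_fiberIdeal (initialIdeal_le ha i) _ (hreg i)
  have hregular := hweak.isRegular_of_isLocalization_of_mem (Localization.AtPrime n) n hzs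
  have hlen : (zs.map (algebraMap _ (Localization.AtPrime n))).length = ℓ := by simp [zs]
  refine ⟨zs.map (algebraMap _ _), ?_, hregular, le_antisymm ?_ ?_⟩
  · intro x hx
    obtain ⟨z, hz, rfl⟩ := List.mem_map.1 hx
    exact (IsLocalization.AtPrime.to_map_mem_maximal_iff _ n z).2 (hzs z hz)
  · rw [← ringKrullDim_add_length_eq_ringKrullDim_of_isRegular _ hregular]
    have : Nontrivial (Localization.AtPrime n ⧸
        Ideal.ofList (zs.map (algebraMap _ (Localization.AtPrime n)))) := by
      refine Ideal.Quotient.nontrivial_iff.2 fun h => hregular.top_ne_smul ?_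
      rw [h]; simp
    exact le_add_of_nonneg_left ringKrullDim_nonneg_of_nontrivial
  · rw [hlen, ← ringKrullDim_reesFiber hℓ hK, IsLocalization.AtPrime.ringKrullDim_eq_height n]
    exact Ideal.height_le_ringKrullDim_of_ne_top (Ideal.IsPrime.ne_top inferInstance)

theorem regular_of_isCohenMacaulay_reesFiber [Infinite (ResidueField R)]
    (hℓ : analyticSpread I = ℓ) (hK : K.radical = maximalIdeal R) (ha : ∀ s, a s ∈ I)
    (hred : IsReduction (initialIdeal a ℓ) I) (hCM : IsCohenMacaulay (ReesFiber I K)) (i : Fin ℓ)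
    (j : ℕ) : ∀ x ∈ I ^ j, a i * x ∈ coeffIdeal I K (initialIdeal a i) (j + 1) →
      x ∈ coeffIdeal I K (initialIdeal a i) j := by
  set M := fiberMaximal I (le_maximalIdeal_of_radical_eq hK) with hM
  let S := Localization.AtPrime M
  obtain ⟨-, rs, hrs, hrsreg, hlen⟩ := hCM.2 M
  rw [IsLocalization.AtPrime.ringKrullDim_eq_height M, height_fiberMaximal hℓ hK] at hlen
  have hreg : IsRegular S ((fiberSequence K ha).map (algebraMap _ S)) := by
    refine isRegular_of_maximalIdeal_le_radical _ ?_ ⟨rs, ?_, hrs, hrsreg⟩ ?_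
    · intro y hy
      obtain ⟨x, hx, rfl⟩ := List.mem_map.1 hy
      obtain ⟨s, rfl⟩ := List.mem_ofFn.1 hx
      exact (IsLocalization.AtPrime.to_map_mem_maximal_iff _ M _).2
        (fiberDegreeOne_mem_fiberMaximal _ _)
    · rw [List.length_map, fiberSequence, List.length_ofFn]
      exact_mod_cast hlen
    · rw [← IsLocalization.AtPrime.map_eq_maximalIdeal M S, ← Ideal.map_ofList]
      refine le_trans ?_ (Ideal.radical_mono le_sup_right)
      refine (Ideal.map_mono (fiberMaximal_le_radical_fiberIdeal hK hred)).trans ?_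
      rw [← ofList_take_fiberSequence ha le_rfl, List.take_of_length_le (by simp [fiberSequence])]
      exact Ideal.map_radical_le _
  have h := (holdsAlong_iff _ _ _).1 ((isWeaklyRegular_iff_holdsAlong _).1 hreg.toIsWeaklyRegular) i
    (by simp [fiberSequence])
  rw [bot_sup_eq, ← List.map_take, ← Ideal.map_ofList, ofList_take_fiberSequence ha i.2.le] at h
  simp only [List.getElem_map, fiberSequence, List.getElem_ofFn] at h
  intro x hx hax
  have hmem : fiberDegreeOne K ⟨a i, ha i⟩ * fiberMonomial K j ⟨x, hx⟩ ∈
      fiberIdeal I K (initialIdeal a i) := by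
    rw [fiberDegreeOne_mul_fiberMonomial]
    exact (fiberMonomial_mem_fiberIdeal_iff (initialIdeal_le ha i) _).2 hax
  have h2 := h (algebraMap _ S (fiberMonomial K j ⟨x, hx⟩)) (by
    rw [← map_mul]; exact Ideal.mem_map_of_mem _ hmem)
  obtain ⟨s, hs, hsx⟩ := (IsLocalization.algebraMap_mem_map_algebraMap_iff M.primeCompl S _ _).1 h2
  exact fiberMonomial_mem_of_mul_mem _ (initialIdeal_le ha i) hs ⟨x, hx⟩ hsx

end CohenMacaulayFiber

/-! ### The equivalence and its form for general elements. -/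

theorem isCohenMacaulay_reesFiber_iff {R : Type*} [CommRing R] [IsLocalRing R] [IsNoetherianRing R]
    [Infinite (IsLocalRing.ResidueField R)] {I K : Ideal R} {ℓ r : ℕ}
    (hℓ : analyticSpread I = (ℓ : WithBot ℕ∞)) {a : Fin ℓ → R} (ha : ∀ i, a i ∈ I)
    (hr : I ^ (r + 1) = initialIdeal a ℓ * I ^ r)
    (hcolon : ∀ i : Fin ℓ, ∀ j : ℕ, 1 ≤ j → j ≤ max 1 r →
      (initialIdeal a i * I ^ (j - 1)).colon {a i} ⊓ I ^ j = initialIdeal a i * I ^ (j - 1))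
    (hK : K.radical = IsLocalRing.maximalIdeal R) :
    IsCohenMacaulay (ReesFiber I K) ↔
      Module.Free (R ⧸ K) (initialIdeal a ℓ ⧸ (K • ⊤ : Submodule R (initialIdeal a ℓ))) ∧
      ∀ j : ℕ, 1 ≤ j → j ≤ r →
        initialIdeal a ℓ * I ^ (j - 1) ⊓ K * I ^ j = initialIdeal a ℓ * K * I ^ (j - 1) := by
  have hKm := le_maximalIdeal_of_radical_eq hK
  have hJI : initialIdeal a ℓ ≤ I := initialIdeal_le ha ℓ
  have hred : IsReduction (initialIdeal a ℓ) I := ⟨hJI, r, hr⟩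
  constructor
  · intro hCM
    have hreg := regular_of_isCohenMacaulay_reesFiber hℓ hK ha hred hCM
    refine ⟨free_quotient_of_coeff_mem initialIdeal_length fun c hc =>
      coeff_mem_of_regular hreg c (Ideal.mul_mono_right hJI hc) ha, fun j hj _ => ?_⟩
    obtain ⟨j, rfl⟩ := Nat.exists_eq_add_of_le' hj
    rw [Nat.add_sub_cancel]
    refine le_antisymm ?_ (le_inf (Ideal.mul_mono_left Ideal.mul_le_left) ?_)
    · rw [mul_assoc]
      exact initialIdeal_mul_inf_le_of_regular ha hreg j ℓ le_rfl
    · rw [mul_comm (initialIdeal a ℓ), mul_assoc, pow_succ']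
      exact Ideal.mul_mono_right (Ideal.mul_mono_left hJI)
  · rintro ⟨hfree, hVV⟩
    have hmin : ∀ c : Fin ℓ → R, ∑ s, c s * a s ∈ K * initialIdeal a ℓ →
        ∀ s, c s ∈ IsLocalRing.maximalIdeal R := fun c hc s =>
      (initialIdeal_length (a := a) ▸ hred).coeff_mem_maximalIdeal hℓ (Ideal.mul_mono hKm hJI hc) s
    refine isCohenMacaulay_reesFiber_of_regular hℓ hK ha fun i j x hx hax =>
      regular_of_basis ha (initialIdeal_inf_pow_le hcolon ha hr)
        (mem_initialIdeal_of_mul_mem hcolon)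
        (coeff_mem_of_free_quotient hKm initialIdeal_length hmin hfree) (fun j => ?_) i j hx hax
    -- Condition (ii) covers only degrees up to `r`; for `j ≥ r` one has `K I^(j+1) = J K I^j`
    -- outright.
    rcases Nat.lt_or_ge j r with hj | hj
    · have := hVV (j + 1) (by omega) hj
      rw [Nat.add_sub_cancel, mul_assoc] at this
      exact this.le
    · obtain ⟨k, rfl⟩ := Nat.exists_eq_add_of_le hj
      refine inf_le_right.trans (le_of_eq ?_)
      rw [show r + k + 1 = r + 1 + k by ring, pow_add, hr, mul_assoc, ← pow_add]
      ring

theorem mainTheorem3 {R : Type*} [CommRing R] [IsLocalRing R] [IsNoetherianRing R]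
    [Infinite (IsLocalRing.ResidueField R)] (I : Ideal R) (ℓ r : ℕ)
    (hℓ : analyticSpread I = (ℓ : WithBot ℕ∞)) (hr : reductionNumber I = r) :
    HoldsForGeneral I ℓ (fun a =>
      (∀ i : Fin ℓ, ∀ j : ℕ, 1 ≤ j → j ≤ max 1 r →
        (initialIdeal a i * I ^ (j - 1)).colon {a i} ⊓ I ^ j = initialIdeal a i * I ^ (j - 1)) →
      ∀ K : Ideal R, K.IsPrimary → K.radical = IsLocalRing.maximalIdeal R →
        (IsCohenMacaulay (ReesQuotient I K) ↔
          Module.Free (R ⧸ K)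
            (initialIdeal a ℓ ⧸ (K • ⊤ : Submodule R (initialIdeal a ℓ))) ∧
          ∀ j : ℕ, 1 ≤ j → j ≤ r →
            initialIdeal a ℓ * I ^ (j - 1) ⊓ K * I ^ j =
              initialIdeal a ℓ * K * I ^ (j - 1))) := by
  intro n f hf
  obtain ⟨b, hbI, hb⟩ := exists_pow_succ_eq_of_reductionNumber_eq hℓ hr
  obtain ⟨g, hg0, hg⟩ := exists_mvPolynomial_pow_succ_eq hf hbI hb
  refine ⟨g, hg0, fun x hx hcolon K _ hK => ?_⟩
  have ha : ∀ i, ∑ s, x (i, s) * f s ∈ I := fun i =>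
    Ideal.sum_mem _ fun s _ => Ideal.mul_mem_left _ _ (hf ▸ Ideal.subset_span ⟨s, rfl⟩)
  exact isCohenMacaulay_reesFiber_iff hℓ ha (by rw [initialIdeal_length]; exact hg x hx) hcolon hK
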